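/- Let $H:\mathbb R^{2n}\to\mathbb R$ be smooth ($C^\infty$), write $y=(p,q)$, $J^{-1}\nabla F=(-\nabla_qF,\nabla_pF)$, and let $\phi_t$ be the (possibly only locally defined) flow of $\dot y=J^{-1}\nabla H(y)$. Consider either of the following two schemes, with evaluation point $s(y_0,y_1)$: (a) symplectic Euler, $s(y_0,y_1)=(p_1,q_0)$; (b) the implicit midpoint rule, $s(y_0,y_1)=\tfrac12(y_0+y_1)$. There are open neighbourhoods $W,D\subseteq\mathbb R^{2n}\times\mathbb R$ of $\mathbb R^{2n}\times\{0\}$ such that for every $y$ the set $\{t:(y,t)\in D\}$ is an interval, for every $t$ the set $\{y:(y,t)\in D\}$ is connected, $\phi_t(y_0)$ exists for all $(y_0,t)\in W$, and $(y_0,t)\mapsto(s(y_0,\phi_t(y_0)),t)$ is a bijection from $W$ onto $D$; and there is a function $\hat H$, smooth on $D$ in all variables, with the following properties. 1. $\hat H$ is a time-dependent modified Hamiltonian: $J^{-1}\nabla_y\hat H(s(y_0,y_1),t)=\dfrac{y_1-y_0}{t}$ for all $(y_0,t)\in W$ with $t\neq0$, where $y_1=\phi_t(y_0)$. Any other function that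 is smooth on $D$ and has this property differs from $\hat H$ on $D$ only by a function of $t$. 2. On $D$, $\hat H$ solves a Hamilton–Jacobi equation: (a) $\ \partial_t\big(t\hat H(p,q,t)\big)=H\big(p,\;q+t\,\partial_p\hat H(p,q,t)\big)$; (b) $\ \partial_t\big(t\hat H(y,t)\big)=H\big(y+\tfrac t2J^{-1}\nabla_y\hat H(y,t)\big)$. 3. If $(y,h)\in D$, then, respectively, (a) $\ h\,\hat H(p,q,h)=\int_0^hH\big(p,q+t\,\partial_p\hat H(p,q,t)\big)\,dt$ with $y=(p,q)$; (b) $\ h\,\hat H(y,h)=\int_0^hH\big(y+\tfrac t2J^{-1}\nabla_y\hat H(y,t)\big)\,dt$. 4. Inserting a formal power series $\sum_kh^kc_k$ for $\hat H$ into the relation in 3 and Taylor expanding the right-hand side determines the $c_k$ recursively: $(k+1)\,c_k(y)$ is the coefficient of $t^k$ at $t=0$ of the right-hand side in 2 with $\hat H$ replaced by $\sum_{j<k}t^jc_j$. This series is the expansion of $\hat H$ in $h$: for all $y$ and $N$, $\hat H(y,h)=\sum_{k<N}h^kc_k(y)+O(h^N)$ as $h\to0$. Moreover each $c_k$ is a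 polynomial with rational coefficients in $H$ and its partial derivatives, and these polynomials depend on the scheme, $n$ and $k$ but not on $H$ or $y$. If moreover the vector field $J^{-1}\nabla H$ is globally Lipschitz, then one can take $W=D=\mathbb R^{2n}\times(-\varepsilon,\varepsilon)$ for some $\varepsilon>0$. -/

import Mathlib

open scoped ContDiff Topology

noncomputable section

/-- Phase space `ℝ²ⁿ`, with points `y = (p, q)`: momenta first, positions second. -/
abbrev PhaseSpace (n : ℕ) : Type :=
  EuclideanSpace ℝ (Fin n) × EuclideanSpace ℝ (Fin n)

/-- The partial gradient `∇_p F` at `y = (p, q)`. -/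
def gradP {n : ℕ} (F : PhaseSpace n → ℝ) (y : PhaseSpace n) : EuclideanSpace ℝ (Fin n) :=
  gradient (fun p => F (p, y.2)) y.1

/-- The partial gradient `∇_q F` at `y = (p, q)`. -/
def gradQ {n : ℕ} (F : PhaseSpace n → ℝ) (y : PhaseSpace n) : EuclideanSpace ℝ (Fin n) :=
  gradient (fun q => F (y.1, q)) y.2

/-- The Hamiltonian vector field `J⁻¹ ∇F = (-∇_q F, ∇_p F)`. -/
def hamVec {n : ℕ} (F : PhaseSpace n → ℝ) (y : PhaseSpace n) : PhaseSpace n :=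
  (-gradQ F y, gradP F y)

/-- `φ_t(y₀)` is well defined and equal to `y₁`: Hamilton's equation `ẏ = J⁻¹ ∇H(y)` has a solution
on the closed interval between `0` and `t` (of either sign) that starts at `y₀` and is at `y₁` at
time `t`. -/
def FlowsTo {n : ℕ} (H : PhaseSpace n → ℝ) (t : ℝ) (y₀ y₁ : PhaseSpace n) : Prop :=
  ∃ γ : ℝ → PhaseSpace n, γ 0 = y₀ ∧ γ t = y₁ ∧
    ∀ τ ∈ Set.uIcc 0 t, HasDerivWithinAt γ (hamVec H (γ τ)) (Set.uIcc 0 t) τ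

/-- The point `(p₁, q₀)` at which symplectic Euler evaluates the vector field. -/
def eulerStage {n : ℕ} (y₀ y₁ : PhaseSpace n) : PhaseSpace n := (y₁.1, y₀.2)

/-- The point `(y₀ + y₁) / 2` at which the implicit midpoint rule evaluates the vector field. -/
def midpointStage {n : ℕ} (y₀ y₁ : PhaseSpace n) : PhaseSpace n := (1 / 2 : ℝ) • (y₀ + y₁)

/-- The argument `(p, q + t ∂_p F(p, q))` of `H` in the Hamilton-Jacobi equation of
symplectic Euler. -/
def eulerPoint {n : ℕ} (F : PhaseSpace n → ℝ) (t : ℝ) (y : PhaseSpace n) : PhaseSpace n :=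
  (y.1, y.2 + t • gradP F y)

/-- The argument `y + (t/2) J⁻¹ ∇F(y)` of `H` in the Hamilton-Jacobi equation of the
implicit midpoint rule. -/
def midpointPoint {n : ℕ} (F : PhaseSpace n → ℝ) (t : ℝ) (y : PhaseSpace n) : PhaseSpace n :=
  y + (t / 2) • hamVec F y

/-- Domains for a scheme with evaluation point `s y₀ y₁`. `W` is an open neighbourhood of
`{t = 0}` in the space of initial values and times `(y₀, t)`, `D` one in the space of evaluation
points and times. The flow `y₁ = φ_t(y₀)` exists on `W`, and `(y₀, t) ↦ (s y₀ y₁, t)` is a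
bijection from `W` onto `D`. For fixed `y` the times in `D` form an interval, and for fixed `t`
the points in `D` form a connected set. -/
structure IsSchemeDomain {n : ℕ} (s : PhaseSpace n → PhaseSpace n → PhaseSpace n)
    (H : PhaseSpace n → ℝ) (W D : Set (PhaseSpace n × ℝ)) : Prop where
  isOpen_initial : IsOpen W
  zero_mem_initial : ∀ y, (y, (0 : ℝ)) ∈ W
  isOpen_stage : IsOpen D
  zero_mem_stage : ∀ y, (y, (0 : ℝ)) ∈ D
  ordConnected_times : ∀ y, Set.OrdConnected {t : ℝ | (y, t) ∈ D}
  isPreconnected_slice : ∀ t : ℝ, IsPreconnected {y | (y, t) ∈ D}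
  flow_mem : ∀ y₀ t, (y₀, t) ∈ W → ∃ y₁, FlowsTo H t y₀ y₁ ∧ (s y₀ y₁, t) ∈ D
  existsUnique_initial : ∀ y t, (y, t) ∈ D →
    ∃! y₀, (y₀, t) ∈ W ∧ ∃ y₁, FlowsTo H t y₀ y₁ ∧ s y₀ y₁ = y

/-- `Hhat` is a smooth time-dependent modified Hamiltonian for the scheme with evaluation point
`s y₀ y₁`: it is smooth in all variables on `D`, and
`J⁻¹ ∇Hhat(s y₀ y₁, t) = (y₁ - y₀) / t` whenever `y₁ = φ_t(y₀)`, `(y₀, t) ∈ W` and `t ≠ 0`. -/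
structure IsModifiedHamiltonian {n : ℕ} (s : PhaseSpace n → PhaseSpace n → PhaseSpace n)
    (H : PhaseSpace n → ℝ) (W D : Set (PhaseSpace n × ℝ)) (Hhat : PhaseSpace n → ℝ → ℝ) :
    Prop where
  smooth : ContDiffOn ℝ ∞ (fun z : PhaseSpace n × ℝ => Hhat z.1 z.2) D
  hamVec_eq : ∀ y₀ t, (y₀, t) ∈ W → t ≠ 0 → ∀ y₁, FlowsTo H t y₀ y₁ →
    hamVec (fun y => Hhat y t) (s y₀ y₁) = t⁻¹ • (y₁ - y₀)

/-- The coefficients `c₀, c₁, …` of the formal power series `∑ hᵏ cₖ` generated by integrating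
`∂_t (t Hhat) = H(arg Hhat t y)` from `0` to `h` and Taylor expanding the right-hand side: insert
the series found so far, take the coefficient of `tᵏ`, and integrate it (which divides it
by `k + 1` once the common factor `h` is removed). The terms `tʲ cⱼ` with `j ≥ k` only affect
powers above `tᵏ` of the right-hand side. -/
def formalCoeff {n : ℕ} (arg : (PhaseSpace n → ℝ) → ℝ → PhaseSpace n → PhaseSpace n)
    (H : PhaseSpace n → ℝ) (k : ℕ) (y : PhaseSpace n) : ℝ :=
  1 / ((k : ℝ) + 1) * (1 / (k.factorial : ℝ) *
    iteratedDeriv k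
      (fun t : ℝ => H (arg (fun x => ∑ j : Fin k, t ^ (j : ℕ) * formalCoeff arg H j x) t y)) 0)
termination_by k
decreasing_by exact j.2

/-- The coordinate vectors of phase space: `Sum.inl i` for `pᵢ`, `Sum.inr i` for `qᵢ`. -/
def coordVec {n : ℕ} : Fin n ⊕ Fin n → PhaseSpace n
  | Sum.inl i => (EuclideanSpace.single i 1, 0)
  | Sum.inr i => (0, EuclideanSpace.single i 1)

/-- The iterated partial derivative of `H` along a list of coordinates; the empty list gives `H`. -/
def partialDerivs {n : ℕ} (H : PhaseSpace n → ℝ) : List (Fin n ⊕ Fin n) → PhaseSpace n → ℝ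
  | [] => H
  | i :: l => fun y => fderiv ℝ (partialDerivs H l) y (coordVec i)

end

/-! Both evaluation points have the form y₀ + L(y₁ - y₀) with L = diag(c, 1 - c): c = 1 is
symplectic Euler and c = 1/2 the midpoint rule, so one proof serves both. A solution on [0, t],
rescaled to a path γ on [0, 1], has evaluation point y exactly when γ = y + t A(f ∘ γ), where f =
J⁻¹∇H and A a = ∫₀^τ a - L ∫₀¹ a. For Lipschitz f and small t this is a contraction on C([0, 1],
ℝ²ⁿ), and the implicit function theorem makes its solution Γ(y, t) smooth, also through t = 0.
Cut-offs and gluing handle general H (`exists_stage_paths`).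

Let Ω be the symplectic form with dF = Ω(J⁻¹∇F, ·). Since Ω(Lu, v) + Ω(u, Lv) = Ω(u, v), integration
by parts makes A skew-adjoint for ∫Ω. Hence the action Ĥ = ∫(H + ½Ω(γ, f(γ))) - ½Ω(y, ∫f(γ))
satisfies d(tĤ) = Ω(y₁ - y₀, dy) + H(y₁) dt (`fderiv_mul_modifiedHam`). The dy part is the modified
equation. It gives y₁ = y + t(1 - L)J⁻¹∇Ĥ, which turns the dt part into the Hamilton–Jacobi
equation.

For the expansion, the Hamilton–Jacobi equation is differentiated k times at t = 0. Because of the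
factor t in the argument of H, only space derivatives of ∂ₜʲĤ with j < k enter, so the Taylor
coefficients obey the recursion of `formalCoeff` (`iteratedDeriv_eq_formalCoeff`). Differentiation
along the argument is modelled by a derivation of a polynomial ring over ℚ that does not involve H,
whence the universal polynomials (`exists_formalCoeff_eq_aeval`). -/

noncomputable section

universe u

set_option linter.unusedSectionVars false

/-! ### Smoothness of composition operators on spaces of continuous maps -/

section Superposition

variable {K : Type*} [TopologicalSpace K] [CompactSpace K]
  {E F : Type u} [NormedAddCommGroup E] [NormedSpace ℝ E] [NormedAddCommGroup F] [NormedSpace ℝ F]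

/-- The superposition (Nemytskii) operator `γ ↦ f ∘ γ` on continuous maps. -/
def superposition (f : C(E, F)) (γ : C(K, E)) : C(K, F) := f.comp γ

@[simp]
theorem superposition_apply (f : C(E, F)) (γ : C(K, E)) (x : K) :
    superposition f γ x = f (γ x) := rfl

/-- Pointwise application of a continuous family of operators to a continuous map. -/
def pointwiseApply : C(K, E →L[ℝ] F) →L[ℝ] C(K, E) →L[ℝ] C(K, F) :=
  LinearMap.mkContinuous₂
    (LinearMap.mk₂ ℝ (fun (φ : C(K, E →L[ℝ] F)) (h : C(K, E)) =>
        (⟨fun x => φ x (h x), φ.continuous.clm_apply h.continuous⟩ : C(K, F)))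
      (fun _ _ _ => by ext; simp) (fun _ _ _ => by ext; simp)
      (fun _ _ _ => by ext; simp) (fun _ _ _ => by ext; simp))
    1 (fun φ h => by
      rw [one_mul, ContinuousMap.norm_le _ (by positivity)]
      intro x
      exact ((φ x).le_opNorm (h x)).trans
        (mul_le_mul (φ.norm_coe_le_norm x) (h.norm_coe_le_norm x) (norm_nonneg _)
          ((norm_nonneg _).trans (φ.norm_coe_le_norm x))))

@[simp]
theorem pointwiseApply_apply (φ : C(K, E →L[ℝ] F)) (h : C(K, E)) (x : K) :
    pointwiseApply φ h x = φ x (h x) := rfl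

/-- The derivative of a `C¹` map as a bundled continuous map. -/
def fderivMap (f : C(E, F)) (hf : ContDiff ℝ 1 f) : C(E, E →L[ℝ] F) :=
  ⟨fderiv ℝ f, hf.continuous_fderiv one_ne_zero⟩

/-- The mean value inequality on each segment from γ x to γ x + h x. The estimate is uniform in x
because γ ↦ Df ∘ γ is continuous in the sup norm. -/
theorem hasFDerivAt_superposition (f : C(E, F)) (hf : ContDiff ℝ 1 f) (γ : C(K, E)) :
    HasFDerivAt (superposition f) (pointwiseApply (superposition (fderivMap f hf) γ)) γ := by
  have hcont : Continuous (superposition (K := K) (fderivMap f hf)) :=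
    ContinuousMap.continuous_postcomp _
  rw [hasFDerivAt_iff_isLittleO_nhds_zero, Asymptotics.isLittleO_iff]
  intro ε hε
  obtain ⟨δ, hδ, hball⟩ := Metric.continuousAt_iff.1 hcont.continuousAt ε hε
  filter_upwards [Metric.ball_mem_nhds (0 : C(K, E)) hδ] with h hh
  rw [ContinuousMap.norm_le _ (by positivity)]
  intro x
  have hseg : ∀ z ∈ segment ℝ (γ x) (γ x + h x), ‖fderiv ℝ f z - fderiv ℝ f (γ x)‖ ≤ ε := by
    intro z hz
    rw [segment_eq_image'] at hz
    obtain ⟨θ, hθ, rfl⟩ := hz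
    have h1 : dist (γ + θ • h) γ < δ := by
      rw [dist_eq_norm, add_sub_cancel_left, norm_smul, Real.norm_of_nonneg hθ.1]
      refine lt_of_le_of_lt (mul_le_of_le_one_left (norm_nonneg _) hθ.2) ?_
      simpa using hh
    have h2 := (ContinuousMap.dist_apply_le_dist x).trans_lt (hball h1)
    rw [dist_eq_norm] at h2
    simpa [fderivMap] using h2.le
  have key := (convex_segment (γ x) (γ x + h x)).norm_image_sub_le_of_norm_fderiv_le'
    (fun z _ => (hf.differentiable one_ne_zero) z) hseg
    (left_mem_segment ℝ _ _) (right_mem_segment ℝ _ _)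
  simp only [ContinuousMap.sub_apply, superposition_apply, ContinuousMap.add_apply,
    pointwiseApply_apply]
  simp only [add_sub_cancel_left] at key
  refine key.trans ?_
  gcongr
  exact h.norm_coe_le_norm x

/-- The derivative is again a superposition operator, that of Df, followed by a bounded linear map.
Its target is E →L[ℝ] F, so the induction must quantify over F, and the shared universe keeps that
target admissible. -/
theorem contDiff_superposition_nat (m : ℕ) : ∀ {F : Type u} [NormedAddCommGroup F]
    [NormedSpace ℝ F] (f : C(E, F)), ContDiff ℝ m f →
      ContDiff ℝ m (superposition (K := K) f) := by
  induction m with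
  | zero =>
    intro F _ _ f _
    exact contDiff_zero.2 (ContinuousMap.continuous_postcomp f)
  | succ m ih =>
    intro F _ _ f hf
    have hf1 : ContDiff ℝ 1 f := hf.of_le (by norm_cast; omega)
    have hd := fun γ : C(K, E) => hasFDerivAt_superposition f hf1 γ
    push_cast at hf ⊢
    refine contDiff_succ_iff_fderiv.2 ⟨fun γ => (hd γ).differentiableAt, by simp, ?_⟩
    have : fderiv ℝ (superposition (K := K) f)
        = fun γ => pointwiseApply (superposition (fderivMap f hf1) γ) :=
      funext fun γ => (hd γ).fderiv
    rw [this]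
    exact pointwiseApply.contDiff.comp
      (ih (fderivMap f hf1) (contDiff_succ_iff_fderiv.1 hf).2.2)

theorem contDiff_superposition (f : C(E, F)) (hf : ContDiff ℝ ∞ f) :
    ContDiff ℝ ∞ (superposition (K := K) f) :=
  contDiff_infty.2 fun m => contDiff_superposition_nat m f (hf.of_le (mod_cast le_top))

theorem lipschitzWith_superposition (f : C(E, F)) {C : NNReal} (hf : LipschitzWith C f) :
    LipschitzWith C (superposition (K := K) f) :=
  LipschitzWith.of_dist_le_mul fun γ₁ γ₂ =>
    (ContinuousMap.dist_le (by positivity)).2 fun x =>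
      (hf.dist_le_mul _ _).trans
        (mul_le_mul_of_nonneg_left (ContinuousMap.dist_apply_le_dist x) C.2)

end Superposition

/-! ### A parametrized fixed point equation in path space -/

section FixedPoint

variable {K : Type*} [TopologicalSpace K] [CompactSpace K]
  {E : Type u} [NormedAddCommGroup E] [NormedSpace ℝ E]

/-- The constant map, as a continuous linear map in its value. -/
def constCLM (K : Type*) [TopologicalSpace K] [CompactSpace K] (E : Type u)
    [NormedAddCommGroup E] [NormedSpace ℝ E] : E →L[ℝ] C(K, E) :=
  LinearMap.mkContinuous
    { toFun := ContinuousMap.const K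
      map_add' := fun _ _ => rfl
      map_smul' := fun _ _ => rfl } 1 (fun x => by
        rw [one_mul, ContinuousMap.norm_le _ (norm_nonneg _)]
        exact fun _ => le_rfl)

@[simp]
theorem constCLM_apply (y : E) (x : K) : constCLM K E y x = y := rfl

/-- For a smooth, globally Lipschitz `f` and short times `t`, the equation
`γ = y + t A (f ∘ γ)` has a unique solution, which depends smoothly on `(y, t)`. -/
theorem exists_smooth_fixedPoint [CompleteSpace E] (A : C(K, E) →L[ℝ] C(K, E)) (f : C(E, E))
    (hf : ContDiff ℝ ∞ f) {C : NNReal} (hC : LipschitzWith C f) :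
    ∃ ε : ℝ, 0 < ε ∧ ∃ Γ : E × ℝ → C(K, E),
      ContDiffOn ℝ ∞ Γ (Set.univ ×ˢ Set.Ioo (-ε) ε) ∧
      ∀ y t, t ∈ Set.Ioo (-ε) ε → ∀ γ,
        γ = constCLM K E y + t • A (superposition f γ) ↔ γ = Γ (y, t) := by
  set N : C(K, E) → C(K, E) := superposition f with hN
  have hNs : ContDiff ℝ ∞ N := contDiff_superposition f hf
  have hNL : LipschitzWith C N := lipschitzWith_superposition f hC
  -- The contraction constant is |t|‖A‖C; the summand 1 covers ‖A‖C = 0.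
  set ε : ℝ := (‖A‖ * C + 1)⁻¹ with hε
  have hεpos : 0 < ε := by positivity
  have hsmall : ∀ t ∈ Set.Ioo (-ε) ε, |t| * (‖A‖ * C) < 1 := by
    intro t ht
    have h1 : |t| < ε := abs_lt.2 ht
    have h2 : |t| * (‖A‖ * C + 1) < 1 := by
      calc |t| * (‖A‖ * C + 1) < ε * (‖A‖ * C + 1) := by gcongr
        _ = 1 := inv_mul_cancel₀ (by positivity)
    nlinarith [abs_nonneg t]
  have hcontr : ∀ y t, t ∈ Set.Ioo (-ε) ε →
      ContractingWith (Real.toNNReal (|t| * (‖A‖ * C)))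
        (fun γ => constCLM K E y + t • A (N γ)) := by
    intro y t ht
    refine ⟨Real.toNNReal_lt_one.2 (hsmall t ht), LipschitzWith.of_dist_le_mul fun γ₁ γ₂ => ?_⟩
    rw [Real.coe_toNNReal _ (by positivity), dist_add_left, dist_eq_norm, ← smul_sub, ← map_sub,
      norm_smul, Real.norm_eq_abs, mul_assoc, mul_assoc]
    gcongr
    refine (A.le_opNorm _).trans ?_
    gcongr
    rw [← dist_eq_norm]
    exact hNL.dist_le_mul _ _
  have hex : ∀ z : E × ℝ, ∃ γ, z.2 ∈ Set.Ioo (-ε) ε → ∀ γ',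
      γ' = constCLM K E z.1 + z.2 • A (N γ') ↔ γ' = γ := by
    intro z
    by_cases hz : z.2 ∈ Set.Ioo (-ε) ε
    · refine ⟨(hcontr z.1 z.2 hz).fixedPoint, fun _ γ' => ⟨fun h => ?_, ?_⟩⟩
      · exact (hcontr z.1 z.2 hz).fixedPoint_unique h.symm
      · rintro rfl
        exact (hcontr z.1 z.2 hz).fixedPoint_isFixedPt.symm
    · exact ⟨0, fun h => absurd h hz⟩
  choose Γ hΓ using hex
  refine ⟨ε, hεpos, Γ, ?_, fun y t ht γ => hΓ (y, t) ht γ⟩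
  have hopen : IsOpen ((Set.univ : Set E) ×ˢ Set.Ioo (-ε) ε) := isOpen_univ.prod isOpen_Ioo
  intro z hz
  refine ContDiffAt.contDiffWithinAt ?_
  set G : (E × ℝ) × C(K, E) → C(K, E) :=
    fun w => w.2 - (constCLM K E w.1.1 + w.1.2 • A (N w.2)) with hG
  have hGs : ContDiff ℝ ∞ G := by
    have : ContDiff ℝ ∞ fun w : (E × ℝ) × C(K, E) => A (N w.2) :=
      A.contDiff.comp (hNs.comp contDiff_snd)
    have h3 : ContDiff ℝ ∞ fun w : (E × ℝ) × C(K, E) => constCLM K E w.1.1 :=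
      (constCLM K E).contDiff.comp (contDiff_fst.comp contDiff_fst)
    exact contDiff_snd.sub (h3.add ((contDiff_snd.comp contDiff_fst).smul this))
  -- The partial derivative in γ is 1 - t A ∘ DN, invertible by a Neumann series since the Lipschitz
  -- bound on N also bounds DN.
  have hinv : (fderiv ℝ G (z, Γ z) ∘L .inr ℝ (E × ℝ) C(K, E)).IsInvertible := by
    have hder : HasFDerivAt (fun γ => G (z, γ))
        (fderiv ℝ G (z, Γ z) ∘L .inr ℝ (E × ℝ) C(K, E)) (Γ z) :=
      ((hGs.differentiable (by simp)) _).hasFDerivAt.comp (Γ z)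
        (hasFDerivAt_prodMk_right z (Γ z))
    have hNd : HasFDerivAt N (fderiv ℝ N (Γ z)) (Γ z) :=
      (hNs.differentiable (by simp) _).hasFDerivAt
    have hder2 : HasFDerivAt (fun γ => G (z, γ))
        (.id ℝ _ - z.2 • (A ∘L fderiv ℝ N (Γ z))) (Γ z) :=
      (hasFDerivAt_id _).sub
        (((A.hasFDerivAt.comp (Γ z) hNd).const_smul z.2).const_add (constCLM K E z.1))
    rw [hder.unique hder2]
    have hlt : ‖z.2 • (A ∘L fderiv ℝ N (Γ z))‖ < 1 := by
      rw [norm_smul, Real.norm_eq_abs]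
      refine lt_of_le_of_lt ?_ (hsmall z.2 hz.2)
      gcongr
      refine (A.opNorm_comp_le _).trans ?_
      gcongr
      exact norm_fderiv_le_of_lipschitz ℝ hNL
    have hu := isUnit_one_sub_of_norm_lt_one hlt
    exact ⟨ContinuousLinearEquiv.unitsEquiv ℝ C(K, E) hu.unit, rfl⟩
  have hGat : ContDiffAt ℝ ∞ G (z, Γ z) := hGs.contDiffAt
  have hsm := hGat.contDiffAt_implicitFunction (by simp) hinv
  -- Uniqueness of the fixed point identifies Γ with the smooth implicit function near z.
  refine hsm.congr_of_eventuallyEq ?_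
  filter_upwards [hGat.eventually_apply_implicitFunction (by simp) hinv, hopen.mem_nhds hz]
    with w hw hwD
  have hzero : G (z, Γ z) = 0 := sub_eq_zero.2 ((hΓ z hz.2 _).2 rfl)
  rw [hzero] at hw
  exact ((hΓ w hwD.2 _).1 (sub_eq_zero.1 hw)).symm

end FixedPoint

/-! ### Solutions of the differential equation as fixed points -/

section Primitive

variable {E : Type u} [NormedAddCommGroup E] [NormedSpace ℝ E]

/-- Extension of a path on `[0, 1]` to the real line by its end values. -/
def extendPath (a : C(unitInterval, E)) (s : ℝ) : E := a (Set.projIcc 0 1 zero_le_one s)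

theorem continuous_extendPath (a : C(unitInterval, E)) : Continuous (extendPath a) :=
  a.continuous.comp continuous_projIcc

theorem norm_extendPath_le (a : C(unitInterval, E)) (s : ℝ) : ‖extendPath a s‖ ≤ ‖a‖ :=
  a.norm_coe_le_norm _

theorem hasDerivAt_integral_extendPath [CompleteSpace E] (a : C(unitInterval, E)) (s : ℝ) :
    HasDerivAt (fun τ => ∫ r in (0 : ℝ)..τ, extendPath a r) (extendPath a s) s :=
  ((continuous_extendPath a).integral_hasStrictDerivAt 0 s).hasDerivAt

/-- The primitive vanishing at `0` of a path on `[0, 1]`. -/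
def primitive (E : Type u) [NormedAddCommGroup E] [NormedSpace ℝ E] :
    C(unitInterval, E) →L[ℝ] C(unitInterval, E) :=
  LinearMap.mkContinuous
    { toFun := fun a =>
        ⟨fun τ => ∫ s in (0 : ℝ)..τ, extendPath a s,
          (intervalIntegral.continuous_primitive
            (fun _ _ => (continuous_extendPath a).intervalIntegrable _ _) 0).comp
            continuous_subtype_val⟩
      map_add' := fun a b => by
        ext τ
        exact intervalIntegral.integral_add ((continuous_extendPath a).intervalIntegrable _ _)
          ((continuous_extendPath b).intervalIntegrable _ _)
      map_smul' := fun c a => by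
        ext τ
        exact intervalIntegral.integral_smul c (extendPath a) } 1 (fun a => by
    rw [one_mul, ContinuousMap.norm_le _ (norm_nonneg _)]
    intro τ
    refine (intervalIntegral.norm_integral_le_of_norm_le_const
      (fun s _ => norm_extendPath_le a s)).trans ?_
    rw [sub_zero, abs_of_nonneg τ.2.1]
    exact mul_le_of_le_one_right (norm_nonneg _) τ.2.2)

theorem primitive_apply (a : C(unitInterval, E)) (τ : unitInterval) :
    primitive E a τ = ∫ s in (0 : ℝ)..τ, extendPath a s := rfl

@[simp]
theorem primitive_apply_zero (a : C(unitInterval, E)) : primitive E a 0 = 0 := by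
  simp [primitive_apply]

/-- The integral over `[0, 1]`. -/
def pathIntegral (E : Type u) [NormedAddCommGroup E] [NormedSpace ℝ E] :
    C(unitInterval, E) →L[ℝ] E :=
  ContinuousMap.evalCLM ℝ 1 ∘L primitive E

theorem pathIntegral_apply (a : C(unitInterval, E)) :
    pathIntegral E a = ∫ s in (0 : ℝ)..1, extendPath a s := rfl

theorem primitive_one_eq_pathIntegral (a : C(unitInterval, E)) :
    primitive E a 1 = pathIntegral E a := rfl

/-- The primitive `b` of a path normalized by `b 0 + L (b 1 - b 0) = 0`. -/
def stagePrimitive (L : E →L[ℝ] E) : C(unitInterval, E) →L[ℝ] C(unitInterval, E) :=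
  primitive E - constCLM unitInterval E ∘L L ∘L pathIntegral E

theorem stagePrimitive_apply (L : E →L[ℝ] E) (a : C(unitInterval, E)) (τ : unitInterval) :
    stagePrimitive L a τ = primitive E a τ - L (pathIntegral E a) := rfl

/-- Along the integral equation γ 1 - γ 0 = t ∫a, so subtracting L ∫a from the primitive trades the
initial condition for a prescribed evaluation point. -/
theorem eq_stagePrimitive_iff (L : E →L[ℝ] E) (t : ℝ) (γ a : C(unitInterval, E)) (y : E) :
    γ = constCLM unitInterval E y + t • stagePrimitive L a ↔
      γ = constCLM unitInterval E (γ 0) + t • primitive E a ∧ γ 0 + L (γ 1 - γ 0) = y := by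
  constructor
  · intro h
    have h' : ∀ τ, γ τ = y + t • (primitive E a τ - L (pathIntegral E a)) :=
      fun τ => DFunLike.congr_fun h τ
    have h0 := h' 0
    have h1 := h' 1
    rw [primitive_apply_zero] at h0
    rw [primitive_one_eq_pathIntegral] at h1
    refine ⟨?_, ?_⟩
    · ext τ
      simp only [ContinuousMap.add_apply, constCLM_apply, ContinuousMap.smul_apply]
      rw [h' τ, h0]
      module
    · have : γ 1 - γ 0 = t • pathIntegral E a := by rw [h0, h1]; module
      rw [this, h0, map_smul]
      module
  · rintro ⟨h, hy⟩
    have h1 : γ 1 - γ 0 = t • pathIntegral E a := by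
      have := DFunLike.congr_fun h 1
      simp only [ContinuousMap.add_apply, constCLM_apply, ContinuousMap.smul_apply] at this
      rw [primitive_one_eq_pathIntegral] at this
      rw [sub_eq_iff_eq_add', ← this]
    rw [← hy, h1, map_smul]
    conv_lhs => rw [h]
    ext τ
    simp only [ContinuousMap.add_apply, constCLM_apply, ContinuousMap.smul_apply,
      stagePrimitive_apply]
    module

/-- A rescaled solution of the integral equation is a solution of the differential equation. -/
theorem exists_curve_of_eq_primitive [CompleteSpace E] (f : C(E, E)) {t : ℝ}
    {γ : C(unitInterval, E)} {y₀ : E}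
    (h : γ = constCLM unitInterval E y₀ + t • primitive E (superposition f γ)) :
    ∃ c : ℝ → E, c 0 = y₀ ∧ c t = γ 1 ∧
      ∀ σ ∈ Set.uIcc 0 t, HasDerivWithinAt c (f (c σ)) (Set.uIcc 0 t) σ := by
  have h' : ∀ τ, γ τ = y₀ + t • primitive E (superposition f γ) τ :=
    fun τ => DFunLike.congr_fun h τ
  rcases eq_or_ne t 0 with rfl | ht
  · refine ⟨fun _ => y₀, rfl, by simp [h' 1], fun σ _ => ?_⟩
    have hs : (Set.uIcc (0 : ℝ) 0).Subsingleton := by simp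
    exact HasFDerivWithinAt.of_subsingleton hs
  -- Rescaling by σ / t treats positive and negative t alike.
  · have hmem : ∀ σ ∈ Set.uIcc 0 t, σ / t ∈ Set.Icc (0 : ℝ) 1 := by
      intro σ hσ
      rcases le_total 0 t with h0 | h0
      · rw [Set.uIcc_of_le h0] at hσ
        exact ⟨div_nonneg hσ.1 h0, div_le_one_of_le₀ hσ.2 h0⟩
      · rw [Set.uIcc_of_ge h0] at hσ
        exact ⟨div_nonneg_of_nonpos hσ.2 h0, div_le_one_of_ge hσ.1 h0⟩
    set c : ℝ → E :=
      fun σ => y₀ + t • ∫ r in (0 : ℝ)..(σ / t), extendPath (superposition f γ) r with hc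
    have hcγ : ∀ σ (hσ : σ ∈ Set.uIcc 0 t), c σ = γ ⟨σ / t, hmem σ hσ⟩ := fun σ hσ => by
      rw [h' ⟨σ / t, hmem σ hσ⟩, primitive_apply]
    refine ⟨c, by simp [hc], ?_, fun σ hσ => ?_⟩
    · rw [hcγ t Set.right_mem_uIcc]
      congr 1
      exact Subtype.ext (div_self ht)
    · have hd : HasDerivAt c (extendPath (superposition f γ) (σ / t)) σ := by
        have := (((hasDerivAt_integral_extendPath (superposition f γ) (σ / t)).scomp σ
          ((hasDerivAt_id σ).div_const t)).const_smul t).const_add y₀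
        refine this.congr_deriv ?_
        rw [smul_smul, mul_one_div_cancel ht, one_smul]
      refine hd.hasDerivWithinAt.congr_deriv ?_
      rw [hcγ σ hσ, extendPath, superposition_apply,
        Set.projIcc_of_mem zero_le_one (hmem σ hσ)]

/-- Two solutions of an autonomous differential equation with the same initial value agree. -/
theorem curve_unique [FiniteDimensional ℝ E] {f : E → E} (hf : ContDiff ℝ 1 f) {t : ℝ}
    {c₁ c₂ : ℝ → E} (h0 : c₁ 0 = c₂ 0)
    (h1 : ∀ σ ∈ Set.uIcc 0 t, HasDerivWithinAt c₁ (f (c₁ σ)) (Set.uIcc 0 t) σ)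
    (h2 : ∀ σ ∈ Set.uIcc 0 t, HasDerivWithinAt c₂ (f (c₂ σ)) (Set.uIcc 0 t) σ) :
    c₁ t = c₂ t := by
  have hc1 : ContinuousOn c₁ (Set.uIcc 0 t) := fun σ hσ => (h1 σ hσ).continuousWithinAt
  have hc2 : ContinuousOn c₂ (Set.uIcc 0 t) := fun σ hσ => (h2 σ hσ).continuousWithinAt
  -- Both curves stay in one compact ball, where f is Lipschitz, so Grönwall uniqueness applies in
  -- either time direction.
  obtain ⟨R, hR⟩ := ((isCompact_uIcc.image_of_continuousOn hc1).union
    (isCompact_uIcc.image_of_continuousOn hc2)).isBounded.subset_closedBall (0 : E)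
  have hm1 : ∀ σ ∈ Set.uIcc 0 t, c₁ σ ∈ Metric.closedBall (0 : E) R :=
    fun σ hσ => hR (Or.inl ⟨σ, hσ, rfl⟩)
  have hm2 : ∀ σ ∈ Set.uIcc 0 t, c₂ σ ∈ Metric.closedBall (0 : E) R :=
    fun σ hσ => hR (Or.inr ⟨σ, hσ, rfl⟩)
  obtain ⟨C, hC⟩ := LocallyLipschitzOn.exists_lipschitzOnWith_of_compact
    (isCompact_closedBall (0 : E) R) hf.locallyLipschitz.locallyLipschitzOn
  rcases le_total 0 t with ht | ht
  · rw [Set.uIcc_of_le ht] at *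
    have hn : ∀ σ ∈ Set.Ico 0 t, Set.Icc 0 t ∈ 𝓝[Set.Ici σ] σ := fun σ hσ =>
      Filter.mem_of_superset (Icc_mem_nhdsGE hσ.2) (Set.Icc_subset_Icc_left hσ.1)
    exact ODE_solution_unique_of_mem_Icc_right (v := fun _ => f)
      (s := fun _ => Metric.closedBall 0 R) (K := C) (fun _ _ => hC) hc1
      (fun σ hσ => (h1 σ (Set.Ico_subset_Icc_self hσ)).mono_of_mem_nhdsWithin (hn σ hσ))
      (fun σ hσ => hm1 σ (Set.Ico_subset_Icc_self hσ)) hc2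
      (fun σ hσ => (h2 σ (Set.Ico_subset_Icc_self hσ)).mono_of_mem_nhdsWithin (hn σ hσ))
      (fun σ hσ => hm2 σ (Set.Ico_subset_Icc_self hσ)) h0 (Set.right_mem_Icc.2 ht)
  · rw [Set.uIcc_of_ge ht] at *
    have hn : ∀ σ ∈ Set.Ioc t 0, Set.Icc t 0 ∈ 𝓝[Set.Iic σ] σ := fun σ hσ =>
      Filter.mem_of_superset (Icc_mem_nhdsLE hσ.1) (Set.Icc_subset_Icc_right hσ.2)
    exact ODE_solution_unique_of_mem_Icc_left (v := fun _ => f)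
      (s := fun _ => Metric.closedBall 0 R) (K := C) (fun _ _ => hC) hc1
      (fun σ hσ => (h1 σ (Set.Ioc_subset_Icc_self hσ)).mono_of_mem_nhdsWithin (hn σ hσ))
      (fun σ hσ => hm1 σ (Set.Ioc_subset_Icc_self hσ)) hc2
      (fun σ hσ => (h2 σ (Set.Ioc_subset_Icc_self hσ)).mono_of_mem_nhdsWithin (hn σ hσ))
      (fun σ hσ => hm2 σ (Set.Ioc_subset_Icc_self hσ)) h0 (Set.left_mem_Icc.2 ht)

end Primitive

/-! ### The family of solutions indexed by evaluation point and time, and its domain -/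

section PathFamily

variable {E : Type u} [NormedAddCommGroup E] [NormedSpace ℝ E]

/-- For a globally Lipschitz vector field the solutions parametrized by their stage point depend
smoothly on it, and `(stage point, time) ↦ (initial value, time)` is an open map. -/
theorem exists_stage_paths_of_lipschitz [CompleteSpace E] (L : E →L[ℝ] E) (f : C(E, E))
    (hf : ContDiff ℝ ∞ f) {C : NNReal} (hC : LipschitzWith C f) :
    ∃ ε : ℝ, 0 < ε ∧ ∃ Γ : E × ℝ → C(unitInterval, E),
      ContDiffOn ℝ ∞ Γ (Set.univ ×ˢ Set.Ioo (-ε) ε) ∧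
      (∀ y t, t ∈ Set.Ioo (-ε) ε → ∀ γ,
        γ = constCLM unitInterval E y + t • stagePrimitive L (superposition f γ) ↔
          γ = Γ (y, t)) ∧
      (∀ y₀ t, t ∈ Set.Ioo (-ε) ε → ∃ y, Γ (y, t) 0 = y₀) ∧
      ∀ U ⊆ Set.univ ×ˢ Set.Ioo (-ε) ε, IsOpen U →
        IsOpen ((fun z : E × ℝ => (Γ z 0, z.2)) '' U) := by
  obtain ⟨ε₁, hε₁, Γ, hΓs, hΓ⟩ := exists_smooth_fixedPoint (stagePrimitive L) f hf hC
  obtain ⟨ε₂, hε₂, Φ, hΦs, hΦ⟩ := exists_smooth_fixedPoint (primitive E) f hf hC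
  set ε := min ε₁ ε₂ with hε
  have hsub₁ : Set.Ioo (-ε) ε ⊆ Set.Ioo (-ε₁) ε₁ :=
    Set.Ioo_subset_Ioo (neg_le_neg (min_le_left _ _)) (min_le_left _ _)
  have hsub₂ : Set.Ioo (-ε) ε ⊆ Set.Ioo (-ε₂) ε₂ :=
    Set.Ioo_subset_Ioo (neg_le_neg (min_le_right _ _)) (min_le_right _ _)
  -- Φ is indexed by the initial value, Γ by the evaluation point. For fixed t the maps S and y ↦ Γ
  -- (y, t) 0 are mutually inverse, so images under the latter are preimages under the continuous S,
  -- hence open.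
  set S : E × ℝ → E := fun z => Φ z 0 + L (Φ z 1 - Φ z 0) with hS
  have hΦ0 : ∀ y₀ t, t ∈ Set.Ioo (-ε) ε → Φ (y₀, t) 0 = y₀ := by
    intro y₀ t ht
    have := DFunLike.congr_fun ((hΦ y₀ t (hsub₂ ht) _).2 rfl) 0
    simpa using this
  have hΓS : ∀ y₀ t, t ∈ Set.Ioo (-ε) ε → Γ (S (y₀, t), t) = Φ (y₀, t) := by
    intro y₀ t ht
    refine ((hΓ _ t (hsub₁ ht) _).1 ?_).symm
    rw [eq_stagePrimitive_iff, hΦ0 y₀ t ht]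
    exact ⟨(hΦ y₀ t (hsub₂ ht) _).2 rfl, by simp only [hS, hΦ0 y₀ t ht]⟩
  have hSΓ : ∀ y t, t ∈ Set.Ioo (-ε) ε → S (Γ (y, t) 0, t) = y := by
    intro y t ht
    obtain ⟨h1, h2⟩ := (eq_stagePrimitive_iff L t _ _ y).1 ((hΓ y t (hsub₁ ht) _).2 rfl)
    have h3 := (hΦ _ t (hsub₂ ht) _).1 h1
    simp only [hS]
    rw [← h3, h2]
  refine ⟨ε, lt_min hε₁ hε₂, Γ, hΓs.mono (Set.prod_mono le_rfl hsub₁),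
    fun y t ht => hΓ y t (hsub₁ ht), fun y₀ t ht => ⟨S (y₀, t), ?_⟩, fun U hU hUo => ?_⟩
  · rw [hΓS y₀ t ht, hΦ0 y₀ t ht]
  · have hO : IsOpen ((Set.univ : Set E) ×ˢ Set.Ioo (-ε) ε) := isOpen_univ.prod isOpen_Ioo
    have hΦc : ContinuousOn Φ (Set.univ ×ˢ Set.Ioo (-ε) ε) :=
      hΦs.continuousOn.mono (Set.prod_mono le_rfl hsub₂)
    have hev : ∀ x : unitInterval, ContinuousOn (fun z => Φ z x) (Set.univ ×ˢ Set.Ioo (-ε) ε) :=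
      fun x => (ContinuousMap.evalCLM ℝ x).continuous.comp_continuousOn hΦc
    have hSc : ContinuousOn (fun z : E × ℝ => (S z, z.2)) (Set.univ ×ˢ Set.Ioo (-ε) ε) :=
      ((hev 0).add (L.continuous.comp_continuousOn ((hev 1).sub (hev 0)))).prodMk
        continuous_snd.continuousOn
    convert hSc.isOpen_inter_preimage hO hUo using 1
    ext ⟨y₀, t⟩
    constructor
    · rintro ⟨⟨y, t'⟩, hz, heq⟩
      obtain ⟨rfl, rfl⟩ := Prod.mk.inj heq
      refine ⟨⟨trivial, (hU hz).2⟩, ?_⟩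
      simp only [Set.mem_preimage]
      rw [hSΓ y t' (hU hz).2]
      exact hz
    · rintro ⟨⟨-, ht⟩, hz⟩
      refine ⟨_, hz, ?_⟩
      simp only
      rw [hΓS y₀ t ht, hΦ0 y₀ t ht]

theorem isPreconnected_iUnion_balls {ι : Type*} (p : ι → Prop) (r : ι → ℝ) :
    IsPreconnected (⋃ (i : ι) (_ : p i), Metric.ball (0 : E) (r i)) := by
  refine isPreconnected_of_forall (0 : E) fun y hy => ?_
  simp only [Set.mem_iUnion] at hy
  obtain ⟨i, hi, hy⟩ := hy
  exact ⟨Metric.ball 0 (r i), Set.subset_biUnion_of_mem (u := fun i => Metric.ball (0 : E) (r i)) hi,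
    Metric.mem_ball_self (Metric.pos_of_mem_ball hy), hy, (convex_ball 0 _).isPreconnected⟩

variable [CompleteSpace E] [FiniteDimensional ℝ E]

/-- A smooth vector field agrees on a given ball with a globally Lipschitz one, whose solutions
starting in a smaller ball stay in that ball for short times. -/
theorem exists_local_stage_paths (L : E →L[ℝ] E) (f : C(E, E)) (hf : ContDiff ℝ ∞ f)
    {R : ℝ} (hR : 0 < R) :
    ∃ g : C(E, E), Set.EqOn g f (Metric.ball 0 (R + 1)) ∧
      ∃ ε : ℝ, 0 < ε ∧ ∃ Γ : E × ℝ → C(unitInterval, E),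
        ContDiffOn ℝ ∞ Γ (Set.univ ×ˢ Set.Ioo (-ε) ε) ∧
        (∀ y t, t ∈ Set.Ioo (-ε) ε → ∀ γ,
          γ = constCLM unitInterval E y + t • stagePrimitive L (superposition g γ) ↔
            γ = Γ (y, t)) ∧
        (∀ U ⊆ Set.univ ×ˢ Set.Ioo (-ε) ε, IsOpen U →
          IsOpen ((fun z : E × ℝ => (Γ z 0, z.2)) '' U)) ∧
        ∀ y ∈ Metric.ball (0 : E) R, ∀ t ∈ Set.Ioo (-ε) ε, ∀ x,
          Γ (y, t) x ∈ Metric.ball (0 : E) (R + 1) := by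
  let χ : ContDiffBump (0 : E) := ⟨R + 1, R + 2, by positivity, by linarith⟩
  have hgs : ContDiff ℝ ∞ fun x => χ x • f x := χ.contDiff.smul hf
  have hsupp : HasCompactSupport fun x => χ x • f x := χ.hasCompactSupport.smul_right
  obtain ⟨C, hC⟩ := ContDiff.lipschitzWith_of_hasCompactSupport hsupp hgs (by simp)
  obtain ⟨M, hM⟩ := hsupp.exists_bound_of_continuous hgs.continuous
  let g : C(E, E) := ⟨fun x => χ x • f x, hgs.continuous⟩
  have hM0 : 0 ≤ M := (norm_nonneg _).trans (hM 0)
  obtain ⟨ε₁, hε₁, Γ, hΓs, hΓ, -, hΓo⟩ := exists_stage_paths_of_lipschitz L g hgs hC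
  -- B bounds A(g ∘ γ), so |t| < (B + 1)⁻¹ keeps the path at distance less than 1 from y: it remains
  -- where the cut-off equals 1.
  set B : ℝ := ‖stagePrimitive L‖ * M with hB
  have hB0 : 0 ≤ B := by positivity
  set ε : ℝ := min ε₁ (B + 1)⁻¹ with hε
  have hsub : Set.Ioo (-ε) ε ⊆ Set.Ioo (-ε₁) ε₁ :=
    Set.Ioo_subset_Ioo (neg_le_neg (min_le_left _ _)) (min_le_left _ _)
  have hsub' : (Set.univ : Set E) ×ˢ Set.Ioo (-ε) ε ⊆ Set.univ ×ˢ Set.Ioo (-ε₁) ε₁ :=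
    Set.prod_mono le_rfl hsub
  refine ⟨g, fun x hx => ?_, ε, lt_min hε₁ (by positivity), Γ, hΓs.mono hsub',
    fun y t ht => hΓ y t (hsub ht), fun U hU => hΓo U (hU.trans hsub'), ?_⟩
  · have : χ x = 1 := χ.one_of_mem_closedBall (Metric.ball_subset_closedBall hx)
    simp [g, this]
  · intro y hy t ht x
    have heq := DFunLike.congr_fun ((hΓ y t (hsub ht) _).2 rfl) x
    have hb : ‖(t • stagePrimitive L (superposition g (Γ (y, t)))) x‖ < 1 := by
      refine (ContinuousMap.norm_coe_le_norm _ x).trans_lt ?_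
      rw [norm_smul, Real.norm_eq_abs]
      have h1 : ‖stagePrimitive L (superposition g (Γ (y, t)))‖ ≤ B :=
        ((stagePrimitive L).le_opNorm _).trans (mul_le_mul_of_nonneg_left
          ((ContinuousMap.norm_le _ hM0).2 fun x => hM _) (norm_nonneg _))
      have h2 : |t| < (B + 1)⁻¹ := (abs_lt.2 ht).trans_le (min_le_right _ _)
      calc |t| * _ ≤ |t| * B := by gcongr
        _ ≤ (B + 1)⁻¹ * B := by gcongr
        _ < (B + 1)⁻¹ * (B + 1) := by gcongr; linarith
        _ = 1 := inv_mul_cancel₀ (by positivity)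
    rw [heq, mem_ball_zero_iff]
    rw [mem_ball_zero_iff] at hy
    exact (norm_add_le _ _).trans_lt (add_lt_add hy hb)

/-- Solutions parametrized by their stage point and the time, on a domain whose sections are
intervals in time and connected in space. -/
theorem exists_stage_paths (L : E →L[ℝ] E) (f : C(E, E)) (hf : ContDiff ℝ ∞ f) :
    ∃ (D : Set (E × ℝ)) (Γ : E × ℝ → C(unitInterval, E)),
      IsOpen D ∧ (∀ y, (y, (0 : ℝ)) ∈ D) ∧
      (∀ y, Set.OrdConnected {t : ℝ | (y, t) ∈ D}) ∧
      (∀ t : ℝ, IsPreconnected {y | (y, t) ∈ D}) ∧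
      ContDiffOn ℝ ∞ Γ D ∧
      (∀ z ∈ D, Γ z = constCLM unitInterval E z.1 +
        z.2 • stagePrimitive L (superposition f (Γ z))) ∧
      IsOpen ((fun z : E × ℝ => (Γ z 0, z.2)) '' D) ∧
      ((∃ C, LipschitzWith C f) → ∃ ε : ℝ, 0 < ε ∧
        (fun z : E × ℝ => (Γ z 0, z.2)) '' D = Set.univ ×ˢ Set.Ioo (-ε) ε ∧
        D = Set.univ ×ˢ Set.Ioo (-ε) ε) := by
  -- A Lipschitz field gives a full strip at once. Otherwise D is a union of products of growing
  -- balls with time intervals about 0.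
  by_cases hLip : ∃ C, LipschitzWith C f
  · obtain ⟨C, hC⟩ := hLip
    obtain ⟨ε, hε, Γ, hΓs, hΓ, hsurj, hopen⟩ := exists_stage_paths_of_lipschitz L f hf hC
    refine ⟨Set.univ ×ˢ Set.Ioo (-ε) ε, Γ, isOpen_univ.prod isOpen_Ioo, fun y => ?_, fun y => ?_,
      fun t => ?_, hΓs, fun z hz => (hΓ z.1 z.2 hz.2 _).2 rfl,
      hopen _ le_rfl (isOpen_univ.prod isOpen_Ioo), fun _ => ⟨ε, hε, ?_, rfl⟩⟩
    · exact ⟨trivial, neg_lt_zero.2 hε, hε⟩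
    · have : {t : ℝ | (y, t) ∈ (Set.univ : Set E) ×ˢ Set.Ioo (-ε) ε} = Set.Ioo (-ε) ε := by
        ext t; simp
      rw [this]
      exact Set.ordConnected_Ioo
    · by_cases ht : t ∈ Set.Ioo (-ε) ε
      · have : {y : E | (y, t) ∈ (Set.univ : Set E) ×ˢ Set.Ioo (-ε) ε} = Set.univ := by
          ext y; simpa using ht
        rw [this]
        exact isPreconnected_univ
      · have : {y : E | (y, t) ∈ (Set.univ : Set E) ×ˢ Set.Ioo (-ε) ε} = ∅ := by
          ext y; simpa using ht
        rw [this]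
        exact isPreconnected_empty
    · ext ⟨y₀, t⟩
      constructor
      · rintro ⟨⟨y, t'⟩, hz, heq⟩
        obtain ⟨-, rfl⟩ := Prod.mk.inj heq
        exact ⟨trivial, hz.2⟩
      · rintro ⟨-, ht⟩
        obtain ⟨y, hy⟩ := hsurj y₀ t ht
        exact ⟨(y, t), ⟨trivial, ht⟩, by simp [hy]⟩
  · have hR : ∀ k : ℕ, (0 : ℝ) < k + 1 := fun k => by positivity
    choose g hg ε hε Γ hΓs hΓ hΓo hΓb using
      fun k : ℕ => exists_local_stage_paths L f hf (hR k)
    set U : ℕ → Set (E × ℝ) := fun k => Metric.ball 0 ((k : ℝ) + 1) ×ˢ Set.Ioo (-ε k) (ε k) with hU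
    have hUo : ∀ k, IsOpen (U k) := fun k => Metric.isOpen_ball.prod isOpen_Ioo
    have hUs : ∀ k, U k ⊆ Set.univ ×ˢ Set.Ioo (-ε k) (ε k) :=
      fun k => Set.prod_mono (Set.subset_univ _) le_rfl
    -- The path Γ k z stays in the ball of radius k + 2, where every g m with m ≥ k equals f. It
    -- therefore solves the m-th equation too, and uniqueness makes the local families agree on
    -- overlaps.
    have heqn : ∀ k, ∀ z ∈ U k, ∀ m, k ≤ m → Γ k z = constCLM unitInterval E z.1 +
        z.2 • stagePrimitive L (superposition (g m) (Γ k z)) ∧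
        superposition (g m) (Γ k z) = superposition f (Γ k z) := by
      intro k z hz m hkm
      have hsame : ∀ m, k ≤ m → superposition (g m) (Γ k z) = superposition f (Γ k z) := by
        intro m hkm
        ext x
        refine hg m (Metric.ball_subset_ball ?_ (hΓb k z.1 hz.1 z.2 hz.2 x))
        have : (k : ℝ) ≤ m := by exact_mod_cast hkm
        linarith
      refine ⟨?_, hsame m hkm⟩
      rw [hsame m hkm, ← hsame k le_rfl]
      exact (hΓ k z.1 z.2 hz.2 _).2 rfl
    have hcons : ∀ k m z, z ∈ U k → z ∈ U m → k ≤ m → Γ k z = Γ m z := fun k m z hk hm hkm =>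
      (hΓ m z.1 z.2 hm.2 _).1 (heqn k z hk m hkm).1
    have hcons' : ∀ k m z, z ∈ U k → z ∈ U m → Γ k z = Γ m z := fun k m z hk hm =>
      (le_total k m).elim (hcons k m z hk hm) fun h => (hcons m k z hm hk h).symm
    have hex : ∀ z : E × ℝ, ∃ γ, ∀ k, z ∈ U k → γ = Γ k z := by
      intro z
      by_cases hz : ∃ k, z ∈ U k
      · exact ⟨Γ hz.choose z, fun k hk => hcons' _ _ _ hz.choose_spec hk⟩
      · exact ⟨0, fun k hk => absurd ⟨k, hk⟩ hz⟩
    choose Δ hΔ using hex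
    refine ⟨⋃ k, U k, Δ, isOpen_iUnion hUo, fun y => ?_, fun y => ?_, fun t => ?_, ?_, ?_, ?_,
      fun h => absurd h hLip⟩
    · obtain ⟨k, hk⟩ := exists_nat_gt ‖y‖
      refine Set.mem_iUnion.2 ⟨k, ?_, neg_lt_zero.2 (hε k), hε k⟩
      rw [mem_ball_zero_iff]
      exact hk.trans (lt_add_one _)
    · refine ⟨fun a ha b hb x hx => ?_⟩
      obtain ⟨k, hka, hk⟩ := Set.mem_iUnion.1 ha
      obtain ⟨m, hmb, hm⟩ := Set.mem_iUnion.1 hb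
      -- All time intervals contain 0, so the endpoint on the same side of 0 as x supplies the piece
      -- containing x.
      rcases le_total x 0 with h0 | h0
      · exact Set.mem_iUnion.2 ⟨k, hka, hk.1.trans_le hx.1, h0.trans_lt (hε k)⟩
      · exact Set.mem_iUnion.2 ⟨m, hmb, (neg_lt_zero.2 (hε m)).trans_le h0, hx.2.trans_lt hm.2⟩
    · convert isPreconnected_iUnion_balls (E := E) (fun k : ℕ => t ∈ Set.Ioo (-ε k) (ε k))
        (fun k => (k : ℝ) + 1) using 1
      ext y
      simp [hU, and_comm]
    · intro z hz
      obtain ⟨k, hk⟩ := Set.mem_iUnion.1 hz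
      refine ((((hΓs k) z (hUs k hk)).contDiffAt
        ((isOpen_univ.prod isOpen_Ioo).mem_nhds (hUs k hk))).congr_of_eventuallyEq
        ?_).contDiffWithinAt
      filter_upwards [(hUo k).mem_nhds hk] with w hw using hΔ w k hw
    · intro z hz
      obtain ⟨k, hk⟩ := Set.mem_iUnion.1 hz
      obtain ⟨h1, h2⟩ := heqn k z hk k le_rfl
      rw [hΔ z k hk, ← h2]
      exact h1
    · rw [Set.image_iUnion]
      refine isOpen_iUnion fun k => ?_
      convert hΓo k (U k) (hUs k) (hUo k) using 1
      exact Set.image_congr fun z hz => by rw [hΔ z k hz]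

end PathFamily

/-! ### The symplectic form on vectors and on paths -/

section Symplectic

variable {n : ℕ}

/-- The symplectic form `Ω(u, v) = ⟨u_q, v_p⟩ - ⟨u_p, v_q⟩`, normalized so that
`dF = Ω(J⁻¹ ∇F, ·)`. -/
def sympl (n : ℕ) : PhaseSpace n →L[ℝ] PhaseSpace n →L[ℝ] ℝ :=
  (innerSL ℝ).bilinearComp (.snd ℝ _ _) (.fst ℝ _ _) -
    (innerSL ℝ).bilinearComp (.fst ℝ _ _) (.snd ℝ _ _)

theorem sympl_apply (u v : PhaseSpace n) :
    sympl n u v = inner ℝ u.2 v.1 - inner ℝ u.1 v.2 := rfl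

theorem sympl_swap (u v : PhaseSpace n) : sympl n u v = -sympl n v u := by
  rw [sympl_apply, sympl_apply, real_inner_comm v.1, real_inner_comm v.2]
  ring

theorem sympl_self (u : PhaseSpace n) : sympl n u u = 0 := by
  linarith [sympl_swap u u]

/-- The vector representing a linear form with respect to the symplectic form. -/
def symplDual (n : ℕ) : (PhaseSpace n →L[ℝ] ℝ) →L[ℝ] PhaseSpace n where
  toFun ℓ := (-(InnerProductSpace.toDual ℝ _).symm (ℓ ∘L .inr ℝ _ _),
    (InnerProductSpace.toDual ℝ _).symm (ℓ ∘L .inl ℝ _ _))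
  map_add' a b := by
    simp only [ContinuousLinearMap.add_comp, map_add, neg_add, Prod.mk_add_mk]
  map_smul' r a := by
    simp [ContinuousLinearMap.smul_comp]
  cont := by fun_prop

theorem sympl_symplDual (ℓ : PhaseSpace n →L[ℝ] ℝ) (v : PhaseSpace n) :
    sympl n (symplDual n ℓ) v = ℓ v := by
  have h1 : inner ℝ ((InnerProductSpace.toDual ℝ _).symm (ℓ ∘L .inl ℝ _ _)) v.1 = ℓ (v.1, 0) := by
    rw [InnerProductSpace.toDual_symm_apply]; simp
  have h2 : inner ℝ ((InnerProductSpace.toDual ℝ _).symm (ℓ ∘L .inr ℝ _ _)) v.2 = ℓ (0, v.2) := by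
    rw [InnerProductSpace.toDual_symm_apply]; simp
  rw [sympl_apply]
  change inner ℝ ((InnerProductSpace.toDual ℝ _).symm (ℓ ∘L .inl ℝ _ _)) v.1 -
    inner ℝ (-(InnerProductSpace.toDual ℝ _).symm (ℓ ∘L .inr ℝ _ _)) v.2 = ℓ v
  rw [inner_neg_left, h1, h2, sub_neg_eq_add, ← map_add]
  simp

theorem sympl_injective : Function.Injective (sympl n) := by
  rw [injective_iff_map_eq_zero]
  intro u hu
  have h1 := DFunLike.congr_fun hu (u.2, 0)
  have h2 := DFunLike.congr_fun hu (0, u.1)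
  rw [sympl_apply] at h1 h2
  simp at h1 h2
  exact Prod.ext h2 h1

theorem symplDual_sympl (u : PhaseSpace n) : symplDual n (sympl n u) = u :=
  sympl_injective (ContinuousLinearMap.ext fun v => sympl_symplDual _ v)

theorem hamVec_eq_symplDual {F : PhaseSpace n → ℝ} {y : PhaseSpace n}
    (hF : DifferentiableAt ℝ F y) : hamVec F y = symplDual n (fderiv ℝ F y) := by
  have hp : HasFDerivAt (fun p => F (p, y.2)) (fderiv ℝ F y ∘L .inl ℝ _ _) y.1 :=
    HasFDerivAt.comp y.1 (g := F) (f := fun p => (p, y.2)) hF.hasFDerivAt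
      (hasFDerivAt_prodMk_left y.1 y.2)
  have hq : HasFDerivAt (fun q => F (y.1, q)) (fderiv ℝ F y ∘L .inr ℝ _ _) y.2 :=
    HasFDerivAt.comp y.2 (g := F) (f := fun q => (y.1, q)) hF.hasFDerivAt
      (hasFDerivAt_prodMk_right y.1 y.2)
  rw [hamVec, gradP, gradQ, gradient, gradient, hp.fderiv, hq.fderiv]
  rfl

theorem fderiv_eq_sympl_hamVec {F : PhaseSpace n → ℝ} {y : PhaseSpace n}
    (hF : DifferentiableAt ℝ F y) : fderiv ℝ F y = sympl n (hamVec F y) := by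
  refine ContinuousLinearMap.ext fun v => ?_
  rw [hamVec_eq_symplDual hF, sympl_symplDual]

theorem contDiff_hamVec {F : PhaseSpace n → ℝ} (hF : ContDiff ℝ ∞ F) :
    ContDiff ℝ ∞ (hamVec F) := by
  have : hamVec F = fun y => symplDual n (fderiv ℝ F y) :=
    funext fun y => hamVec_eq_symplDual (hF.differentiable (by simp) y)
  rw [this]
  exact (symplDual n).contDiff.comp (contDiff_infty_iff_fderiv.1 hF).2

/-- The linear part of the evaluation point `y₀ + L (y₁ - y₀)` of the scheme with weight `c`. -/
def stageMap (n : ℕ) (c : ℝ) : PhaseSpace n →L[ℝ] PhaseSpace n :=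
  (c • ContinuousLinearMap.id ℝ _).prodMap ((1 - c) • ContinuousLinearMap.id ℝ _)

theorem stageMap_apply (c : ℝ) (u : PhaseSpace n) :
    stageMap n c u = (c • u.1, (1 - c) • u.2) := rfl

/-- Ω pairs p with q only, and the two weights c and 1 - c add up to 1. This is the property of the
scheme that makes its modified field Hamiltonian. -/
theorem sympl_stageMap (c : ℝ) (u v : PhaseSpace n) :
    sympl n (stageMap n c u) v + sympl n u (stageMap n c v) = sympl n u v := by
  simp only [sympl_apply, stageMap_apply, inner_smul_left, inner_smul_right, RCLike.conj_to_real]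
  ring

/-- The pointwise symplectic form of two paths. -/
def symplPath (n : ℕ) : C(unitInterval, PhaseSpace n) →L[ℝ]
    C(unitInterval, PhaseSpace n) →L[ℝ] C(unitInterval, ℝ) :=
  pointwiseApply ∘L (sympl n).compLeftContinuous ℝ unitInterval

theorem pathIntegral_symplPath_const_left (y : PhaseSpace n)
    (b : C(unitInterval, PhaseSpace n)) :
    pathIntegral ℝ (symplPath n (constCLM unitInterval _ y) b) = sympl n y (pathIntegral _ b) := by
  rw [pathIntegral_apply, pathIntegral_apply]
  exact (sympl n y).intervalIntegral_comp_comm ((continuous_extendPath b).intervalIntegrable _ _)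

theorem symplPath_swap (a b : C(unitInterval, PhaseSpace n)) :
    symplPath n a b = -symplPath n b a := by
  ext x
  exact sympl_swap _ _

theorem pathIntegral_symplPath_const_right (y : PhaseSpace n)
    (b : C(unitInterval, PhaseSpace n)) :
    pathIntegral ℝ (symplPath n b (constCLM unitInterval _ y)) = sympl n (pathIntegral _ b) y := by
  rw [symplPath_swap, map_neg, pathIntegral_symplPath_const_left, ← sympl_swap]

/-- Integration by parts for Ω(∫a, ∫b). Both primitives vanish at 0, so only the boundary term at 1
survives. -/
theorem pathIntegral_symplPath_primitive (a b : C(unitInterval, PhaseSpace n)) :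
    pathIntegral ℝ (symplPath n a (primitive _ b)) + pathIntegral ℝ (symplPath n (primitive _ a) b)
      = sympl n (pathIntegral _ a) (pathIntegral _ b) := by
  set P : C(unitInterval, PhaseSpace n) → ℝ → PhaseSpace n :=
    fun a r => ∫ s in (0 : ℝ)..r, extendPath a s with hP
  have hPd : ∀ a r, HasDerivAt (P a) (extendPath a r) r := hasDerivAt_integral_extendPath
  have hPc : ∀ a, Continuous (P a) :=
    fun a => continuous_iff_continuousAt.2 fun r => (hPd a r).continuousAt
  have hPe : ∀ a, ∀ r ∈ Set.uIcc (0 : ℝ) 1, extendPath (primitive _ a) r = P a r := by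
    intro a r hr
    rw [Set.uIcc_of_le zero_le_one] at hr
    rw [extendPath, primitive_apply, Set.projIcc_of_mem zero_le_one hr]
  have hd : ∀ r ∈ Set.uIcc (0 : ℝ) 1, HasDerivAt (fun r => sympl n (P a r) (P b r))
      (sympl n (P a r) (extendPath b r) + sympl n (extendPath a r) (P b r)) r := by
    intro r _
    have := (sympl n).hasFDerivAt_of_bilinear (hPd a r).hasFDerivAt (hPd b r).hasFDerivAt
    simpa using this.hasDerivAt
  have hc1 : Continuous fun r => sympl n (P a r) (extendPath b r) :=
    ((sympl n).continuous.comp (hPc a)).clm_apply (continuous_extendPath b)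
  have hc2 : Continuous fun r => sympl n (extendPath a r) (P b r) :=
    ((sympl n).continuous.comp (continuous_extendPath a)).clm_apply (hPc b)
  have hint := intervalIntegral.integral_eq_sub_of_hasDerivAt hd
    ((hc1.add hc2).intervalIntegrable _ _)
  have hP0 : P a 0 = 0 := intervalIntegral.integral_same
  rw [hP0, map_zero, zero_apply, sub_zero,
    intervalIntegral.integral_add (hc1.intervalIntegrable _ _) (hc2.intervalIntegrable _ _)] at hint
  rw [pathIntegral_apply, pathIntegral_apply, pathIntegral_apply, pathIntegral_apply]
  change _ = sympl n (P a 1) (P b 1)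
  rw [← hint, add_comm]
  congr 1
  · exact intervalIntegral.integral_congr fun r hr => congrArg (fun x => sympl n x _) (hPe a r hr)
  · exact intervalIntegral.integral_congr fun r hr => congrArg (sympl n _) (hPe b r hr)

/-- The normalized primitive is skew-adjoint for the integrated symplectic form. -/
theorem pathIntegral_symplPath_stagePrimitive (c : ℝ) (a b : C(unitInterval, PhaseSpace n)) :
    pathIntegral ℝ (symplPath n a (stagePrimitive (stageMap n c) b)) +
      pathIntegral ℝ (symplPath n (stagePrimitive (stageMap n c) a) b) = 0 := by
  have h : ∀ a, stagePrimitive (stageMap n c) a = primitive _ a -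
      constCLM unitInterval _ (stageMap n c (pathIntegral _ a)) := fun _ => rfl
  rw [h, h, map_sub, map_sub, map_sub, sub_apply, map_sub,
    pathIntegral_symplPath_const_left, pathIntegral_symplPath_const_right]
  -- The boundary term Ω(∫a, ∫b) is exactly what the two corrections by L remove.
  linarith [pathIntegral_symplPath_primitive a b,
    sympl_stageMap c (pathIntegral _ a) (pathIntegral _ b)]

theorem pathIntegral_const (r : ℝ) : pathIntegral ℝ (constCLM unitInterval ℝ r) = r := by
  simp [pathIntegral_apply, extendPath]

end Symplectic

/-! ### The modified Hamiltonian as an action, and its differential -/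

section ModifiedHamiltonian

variable {n : ℕ} {H : PhaseSpace n → ℝ}

/-- The Hamiltonian vector field as a bundled continuous map. -/
def hamMap (H : PhaseSpace n → ℝ) (hH : ContDiff ℝ ∞ H) : C(PhaseSpace n, PhaseSpace n) :=
  ⟨hamVec H, (contDiff_hamVec hH).continuous⟩

/-- The Hamiltonian is constant along its solutions. -/
theorem pathIntegral_comp_of_solution (hH : ContDiff ℝ ∞ H) (L : PhaseSpace n →L[ℝ] PhaseSpace n)
    {γ : C(unitInterval, PhaseSpace n)} {y : PhaseSpace n} {t : ℝ}
    (h : γ = constCLM unitInterval _ y + t • stagePrimitive L (superposition (hamMap H hH) γ)) :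
    pathIntegral ℝ (superposition ⟨H, hH.continuous⟩ γ) = H (γ 1) := by
  have h0 := ((eq_stagePrimitive_iff _ _ _ _ _).1 h).1
  set g := superposition (hamMap H hH) γ with hg
  set c : ℝ → PhaseSpace n := fun r => γ 0 + t • ∫ s in (0 : ℝ)..r, extendPath g s with hc
  have hcγ : ∀ r (hr : r ∈ Set.Icc (0 : ℝ) 1), c r = γ ⟨r, hr⟩ := fun r hr => by
    have := DFunLike.congr_fun h0 ⟨r, hr⟩
    simp only [constCLM_apply, ContinuousMap.add_apply, ContinuousMap.smul_apply,
      primitive_apply] at this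
    rw [this]
  have hcd : ∀ r, HasDerivAt c (t • extendPath g r) r := fun r =>
    ((hasDerivAt_integral_extendPath g r).const_smul t).const_add _
  have hHd : ∀ r ∈ Set.Icc (0 : ℝ) 1, HasDerivAt (fun r => H (c r)) 0 r := by
    intro r hr
    have hdiff := hH.differentiable (by simp) (c r)
    refine (hdiff.hasFDerivAt.comp_hasDerivAt r (hcd r)).congr_deriv ?_
    have : extendPath g r = hamVec H (c r) := by
      rw [hcγ r hr, extendPath, Set.projIcc_of_mem zero_le_one hr, hg, superposition_apply]
      rfl
    rw [fderiv_eq_sympl_hamVec hdiff, map_smul, this, sympl_self, smul_zero]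
  have hconst := constant_of_has_deriv_right_zero (f := fun r => H (c r)) (a := 0) (b := 1)
    (fun r hr => (hHd r hr).continuousAt.continuousWithinAt)
    (fun r hr => (hHd r (Set.Ico_subset_Icc_self hr)).hasDerivWithinAt)
  have hval : ∀ x : unitInterval, H (γ x) = H (c 0) := fun x => by
    rw [← hconst x x.2, hcγ _ x.2]
  have : superposition ⟨H, hH.continuous⟩ γ = constCLM unitInterval ℝ (H (γ 1)) := by
    ext x
    exact (hval x).trans (hval 1).symm
  rw [this, pathIntegral_const]

/-- The integrand `H + ½ Ω(y, J⁻¹ ∇H)` of the symmetric action. -/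
def actionDensity (H : PhaseSpace n → ℝ) (y : PhaseSpace n) : ℝ :=
  H y + (1 / 2) * sympl n y (hamVec H y)

theorem contDiff_actionDensity (hH : ContDiff ℝ ∞ H) : ContDiff ℝ ∞ (actionDensity H) :=
  hH.add (contDiff_const.mul
    (((sympl n).contDiff.comp contDiff_id).clm_apply (contDiff_hamVec hH)))

theorem fderiv_actionDensity (hH : ContDiff ℝ ∞ H) (y v : PhaseSpace n) :
    fderiv ℝ (actionDensity H) y v =
      (1 / 2) * sympl n (hamVec H y) v + (1 / 2) * sympl n y (fderiv ℝ (hamVec H) y v) := by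
  have h1 : HasFDerivAt H (sympl n (hamVec H y)) y := by
    rw [← fderiv_eq_sympl_hamVec (hH.differentiable (by simp) y)]
    exact (hH.differentiable (by simp) y).hasFDerivAt
  have h2 := (sympl n).hasFDerivAt_of_bilinear (hasFDerivAt_id y)
    ((contDiff_hamVec hH).differentiable (by simp) y).hasFDerivAt
  have h3 := h1.add (h2.const_mul (1 / 2))
  have h4 : HasFDerivAt (actionDensity H) _ y := h3
  rw [h4.fderiv]
  simp
  rw [sympl_swap v]
  ring

/-- The modified Hamiltonian attached to a family `Γ` of solutions: the symmetric action of the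
solution, divided by the time. -/
def modifiedHam (hH : ContDiff ℝ ∞ H) (Γ : PhaseSpace n × ℝ → C(unitInterval, PhaseSpace n))
    (z : PhaseSpace n × ℝ) : ℝ :=
  pathIntegral ℝ (superposition ⟨actionDensity H, (contDiff_actionDensity hH).continuous⟩ (Γ z)) -
    (1 / 2) * sympl n z.1 (pathIntegral _ (superposition (hamMap H hH) (Γ z)))

variable {Γ : PhaseSpace n × ℝ → C(unitInterval, PhaseSpace n)} {D : Set (PhaseSpace n × ℝ)}

/-- After rescaling to [0, 1] no division by t is left, so t = 0 needs no separate treatment. -/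
theorem contDiffOn_modifiedHam (hH : ContDiff ℝ ∞ H) (hΓ : ContDiffOn ℝ ∞ Γ D) :
    ContDiffOn ℝ ∞ (modifiedHam hH Γ) D := by
  have h1 := (pathIntegral ℝ).contDiff.comp_contDiffOn
    ((contDiff_superposition (K := unitInterval)
      (⟨actionDensity H, (contDiff_actionDensity hH).continuous⟩ : C(PhaseSpace n, ℝ))
      (contDiff_actionDensity hH)).comp_contDiffOn hΓ)
  have h2 := (pathIntegral (PhaseSpace n)).contDiff.comp_contDiffOn
    ((contDiff_superposition (K := unitInterval) (hamMap H hH)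
      (contDiff_hamVec hH)).comp_contDiffOn hΓ)
  have h3 : ContDiffOn ℝ ∞ (fun z : PhaseSpace n × ℝ => sympl n z.1) D :=
    ((sympl n).contDiff.comp contDiff_fst).contDiffOn
  exact h1.sub (contDiffOn_const.mul (h3.clm_apply h2))

/-- The differential of `t Ĥ` is `Ω(y₁ - y₀, dy) + H dt`. -/
theorem fderiv_mul_modifiedHam (hH : ContDiff ℝ ∞ H) {c : ℝ} (hD : IsOpen D)
    (hΓ : ContDiffOn ℝ ∞ Γ D)
    (heq : ∀ z ∈ D, Γ z = constCLM unitInterval _ z.1 +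
      z.2 • stagePrimitive (stageMap n c) (superposition (hamMap H hH) (Γ z)))
    {z : PhaseSpace n × ℝ} (hz : z ∈ D) (w : PhaseSpace n × ℝ) :
    w.2 * modifiedHam hH Γ z + z.2 * fderiv ℝ (modifiedHam hH Γ) z w =
      w.2 * H (Γ z 1) +
        z.2 * sympl n (pathIntegral _ (superposition (hamMap H hH) (Γ z))) w.1 := by
  set A := stagePrimitive (stageMap n c) with hA
  set γ := Γ z with hγ
  set g := superposition (hamMap H hH) γ with hg
  have hΓd : HasFDerivAt Γ (fderiv ℝ Γ z) z :=
    ((hΓ.contDiffAt (hD.mem_nhds hz)).differentiableAt (by simp)).hasFDerivAt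
  set δ := fderiv ℝ Γ z w with hδ
  have hf1 : ContDiff ℝ 1 (hamMap H hH) := (contDiff_hamVec hH).of_le (by simp)
  have hh1 : ContDiff ℝ 1 (⟨actionDensity H, (contDiff_actionDensity hH).continuous⟩ :
    C(PhaseSpace n, ℝ)) := (contDiff_actionDensity hH).of_le (by simp)
  have hNf := (hasFDerivAt_superposition _ hf1 γ).comp z hΓd
  have hNh := (hasFDerivAt_superposition _ hh1 γ).comp z hΓd
  set k := pointwiseApply (superposition (fderivMap _ hf1) γ) δ with hk
  have hγeq : γ = constCLM unitInterval _ z.1 + A (z.2 • g) := by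
    rw [map_smul]; exact heq z hz
  -- The linearized fixed point equation: k is the variation of g = f ∘ γ, and w = (dy, dt).
  have hδeq : δ = constCLM unitInterval _ w.1 + A (w.2 • g + z.2 • k) := by
    have hder : HasFDerivAt Γ _ z :=
      (((constCLM unitInterval (PhaseSpace n)).hasFDerivAt.comp z hasFDerivAt_fst).add
        (hasFDerivAt_snd.smul (A.hasFDerivAt.comp z hNf))).congr_of_eventuallyEq
        (Filter.eventually_of_mem (hD.mem_nhds hz) heq)
    rw [hδ, hder.fderiv]
    simp only [add_apply, ContinuousLinearMap.comp_apply,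
      smul_apply, ContinuousLinearMap.smulRight_apply,
      ContinuousLinearMap.coe_fst', ContinuousLinearMap.coe_snd', map_add, map_smul]
    rw [add_comm (z.2 • _)]
    rfl
  have hdens : pointwiseApply (superposition (fderivMap _ hh1) γ) δ =
      (1 / 2 : ℝ) • symplPath n g δ + (1 / 2 : ℝ) • symplPath n γ k := by
    ext x
    exact fderiv_actionDensity hH (γ x) (δ x)
  have hval : superposition ⟨actionDensity H, (contDiff_actionDensity hH).continuous⟩ γ =
      superposition ⟨H, hH.continuous⟩ γ + (1 / 2 : ℝ) • symplPath n γ g := by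
    ext x
    rfl
  have hcons : pathIntegral ℝ (superposition ⟨H, hH.continuous⟩ γ) = H (γ 1) :=
    pathIntegral_comp_of_solution hH _ (heq z hz)
  have hHd : fderiv ℝ (modifiedHam hH Γ) z w =
      pathIntegral ℝ (pointwiseApply (superposition (fderivMap _ hh1) γ) δ) -
        (1 / 2) * (sympl n z.1 (pathIntegral _ k) + sympl n w.1 (pathIntegral _ g)) := by
    have hd : HasFDerivAt (modifiedHam hH Γ) _ z :=
      ((pathIntegral ℝ).hasFDerivAt.comp z hNh).sub
        (((sympl n).hasFDerivAt_of_bilinear hasFDerivAt_fst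
          ((pathIntegral (PhaseSpace n)).hasFDerivAt.comp z hNf)).const_mul (1 / 2))
    rw [hd.fderiv]
    rfl
  rw [hHd, hdens]
  unfold modifiedHam
  rw [← hγ, ← hg, hval]
  simp only [map_add, map_smul, smul_eq_mul, hcons]
  have e1 : w.2 * pathIntegral ℝ (symplPath n γ g) + z.2 * pathIntegral ℝ (symplPath n γ k) =
      pathIntegral ℝ (symplPath n γ (w.2 • g + z.2 • k)) := by
    simp only [map_add, map_smul, smul_eq_mul]
  have e2 : z.2 * pathIntegral ℝ (symplPath n g δ) = pathIntegral ℝ (symplPath n (z.2 • g) δ) := by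
    simp only [map_smul, smul_apply, smul_eq_mul]
  -- Inserting γ = y + A(t g) and δ = dy + A(dt g + t k), the two terms containing A cancel by
  -- skew-adjointness; only the constant parts y and dy contribute.
  have e3 : pathIntegral ℝ (symplPath n γ (w.2 • g + z.2 • k)) +
      pathIntegral ℝ (symplPath n (z.2 • g) δ) =
      sympl n z.1 (pathIntegral _ (w.2 • g + z.2 • k)) +
        sympl n (pathIntegral _ (z.2 • g)) w.1 := by
    have hskew := pathIntegral_symplPath_stagePrimitive c (z.2 • g) (w.2 • g + z.2 • k)
    rw [← hA] at hskew
    rw [hδeq]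
    conv_lhs => rw [hγeq]
    rw [map_add (symplPath n), add_apply, map_add (symplPath n (z.2 • g)),
      map_add (pathIntegral ℝ), map_add (pathIntegral ℝ), pathIntegral_symplPath_const_left,
      pathIntegral_symplPath_const_right]
    linarith
  simp only [map_add, map_smul, smul_eq_mul, smul_apply] at e3
  have e4 := sympl_swap w.1 (pathIntegral _ g)
  simp only [map_add, map_smul, smul_eq_mul] at e1 e2
  simp only [smul_apply, smul_eq_mul, map_smul] at e2
  -- By antisymmetry the two remaining halves ½tΩ(∫g, dy) and -½tΩ(dy, ∫g) add up.
  linear_combination (1 / 2 : ℝ) * e3 - (1 / 2) * z.2 * e4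

end ModifiedHamiltonian

/-! ### Modified equation, uniqueness and the Hamilton–Jacobi equation -/

section Scheme

variable {n : ℕ}

/-- The evaluation point `y₀ + L (y₁ - y₀)` of the scheme with weight `c`; `c = 1` is symplectic
Euler and `c = 1/2` the implicit midpoint rule. -/
def stagePoint (c : ℝ) (y₀ y₁ : PhaseSpace n) : PhaseSpace n := y₀ + stageMap n c (y₁ - y₀)

/-- The argument `y + t (1 - L) J⁻¹ ∇F(y)` of `H` in the Hamilton-Jacobi equation of the scheme
with weight `c`. -/
def hamiltonJacobiPoint (c : ℝ) (F : PhaseSpace n → ℝ) (t : ℝ) (y : PhaseSpace n) : PhaseSpace n :=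
  y + t • (hamVec F y - stageMap n c (hamVec F y))

theorem eulerStage_eq_stagePoint : eulerStage (n := n) = stagePoint 1 := by
  funext y₀ y₁
  simp [eulerStage, stagePoint, stageMap_apply, Prod.ext_iff]

theorem midpointStage_eq_stagePoint : midpointStage (n := n) = stagePoint (1 / 2) := by
  funext y₀ y₁
  simp only [midpointStage, stagePoint, stageMap_apply, Prod.ext_iff, Prod.smul_fst, Prod.fst_add,
    Prod.fst_sub, Prod.smul_snd, Prod.snd_add, Prod.snd_sub]
  constructor <;> module

theorem eulerPoint_eq_hamiltonJacobiPoint :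
    eulerPoint (n := n) = hamiltonJacobiPoint 1 := by
  funext F t y
  simp [eulerPoint, hamiltonJacobiPoint, stageMap_apply, hamVec, Prod.ext_iff]

theorem midpointPoint_eq_hamiltonJacobiPoint :
    midpointPoint (n := n) = hamiltonJacobiPoint (1 / 2) := by
  funext F t y
  simp only [midpointPoint, hamiltonJacobiPoint, stageMap_apply, hamVec, Prod.ext_iff,
    Prod.fst_add, Prod.snd_add, Prod.smul_fst, Prod.smul_snd, Prod.fst_sub, Prod.snd_sub]
  constructor <;> module

variable {D : Set (PhaseSpace n × ℝ)}

theorem hasFDerivAt_slice {F : PhaseSpace n × ℝ → ℝ} {z : PhaseSpace n × ℝ}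
    (hF : DifferentiableAt ℝ F z) :
    HasFDerivAt (fun y => F (y, z.2)) (fderiv ℝ F z ∘L .inl ℝ _ _) z.1 :=
  HasFDerivAt.comp z.1 (g := F) (f := fun y => (y, z.2)) hF.hasFDerivAt
    (hasFDerivAt_prodMk_left z.1 z.2)

theorem hasDerivAt_time {F : PhaseSpace n × ℝ → ℝ} {z : PhaseSpace n × ℝ}
    (hF : DifferentiableAt ℝ F z) :
    HasDerivAt (fun t => F (z.1, t)) (fderiv ℝ F z (0, 1)) z.2 := by
  have := HasFDerivAt.comp z.2 (g := F) (f := fun t => (z.1, t)) hF.hasFDerivAt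
    (hasFDerivAt_prodMk_right z.1 z.2)
  exact this.hasDerivAt.congr_deriv (by simp)

/-- Two modified Hamiltonians whose vector fields agree off `t = 0` differ by a function of
time. -/
theorem eq_add_of_hamVec_eq (hD : IsOpen D) (hconn : ∀ t : ℝ, IsPreconnected {y | (y, t) ∈ D})
    {F G : PhaseSpace n × ℝ → ℝ} (hF : ContDiffOn ℝ ∞ F D) (hG : ContDiffOn ℝ ∞ G D)
    (h : ∀ y t, (y, t) ∈ D → t ≠ 0 →
      hamVec (fun x => G (x, t)) y = hamVec (fun x => F (x, t)) y) :
    ∃ c : ℝ → ℝ, ∀ y t, (y, t) ∈ D → G (y, t) = F (y, t) + c t := by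
  have hFd : ∀ z ∈ D, DifferentiableAt ℝ F z := fun z hz =>
    (hF.contDiffAt (hD.mem_nhds hz)).differentiableAt (by simp)
  have hGd : ∀ z ∈ D, DifferentiableAt ℝ G z := fun z hz =>
    (hG.contDiffAt (hD.mem_nhds hz)).differentiableAt (by simp)
  have hne : ∀ z ∈ D, z.2 ≠ 0 → fderiv ℝ G z ∘L .inl ℝ _ _ = fderiv ℝ F z ∘L .inl ℝ _ _ := by
    intro z hz hz2
    have h1 := hasFDerivAt_slice (hFd z hz)
    have h2 := hasFDerivAt_slice (hGd z hz)
    rw [← h1.fderiv, ← h2.fderiv, fderiv_eq_sympl_hamVec h1.differentiableAt,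
      fderiv_eq_sympl_hamVec h2.differentiableAt, h z.1 z.2 hz hz2]
  -- The slice t = 0 is reached by continuity of the derivatives along nearby nonzero times.
  have hall : ∀ z ∈ D, fderiv ℝ G z ∘L .inl ℝ _ _ = fderiv ℝ F z ∘L .inl ℝ _ _ := by
    rintro ⟨y, t⟩ hz
    have hcont : ContinuousOn (fun z => fderiv ℝ G z - fderiv ℝ F z) D :=
      (hG.continuousOn_fderiv_of_isOpen hD (by simp)).sub
        (hF.continuousOn_fderiv_of_isOpen hD (by simp))
    have hcont2 : ContinuousAt (fun τ : ℝ => (fderiv ℝ G (y, τ) - fderiv ℝ F (y, τ)) ∘L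
        .inl ℝ (PhaseSpace n) ℝ) t := by
      have h1 : ContinuousAt (fun τ : ℝ => fderiv ℝ G (y, τ) - fderiv ℝ F (y, τ)) t :=
        ContinuousAt.comp (g := fun z => fderiv ℝ G z - fderiv ℝ F z) (f := fun τ : ℝ => (y, τ))
          (hcont.continuousAt (hD.mem_nhds hz)) (by fun_prop)
      exact h1.clm_comp continuousAt_const
    have hev : ∀ᶠ τ in 𝓝[≠] t, (fderiv ℝ G (y, τ) - fderiv ℝ F (y, τ)) ∘L
        .inl ℝ (PhaseSpace n) ℝ = 0 := by
      have hmem : ∀ᶠ τ in 𝓝 t, (y, τ) ∈ D :=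
        (by fun_prop : ContinuousAt (fun τ : ℝ => (y, τ)) t) (hD.mem_nhds hz)
      have hne0 : ∀ᶠ τ in 𝓝[≠] t, τ ≠ 0 := by
        rcases eq_or_ne t 0 with rfl | ht
        · exact self_mem_nhdsWithin
        · exact nhdsWithin_le_nhds (isOpen_ne.mem_nhds ht)
      filter_upwards [nhdsWithin_le_nhds hmem, hne0] with τ h1 h2
      rw [ContinuousLinearMap.sub_comp, hne (y, τ) h1 h2, sub_self]
    have hlim : (fderiv ℝ G (y, t) - fderiv ℝ F (y, t)) ∘L .inl ℝ (PhaseSpace n) ℝ = 0 :=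
      tendsto_nhds_unique (hcont2.tendsto.mono_left nhdsWithin_le_nhds)
        (tendsto_const_nhds.congr' (hev.mono fun _ h => h.symm))
    rwa [ContinuousLinearMap.sub_comp, sub_eq_zero] at hlim
  have hslice : ∀ t : ℝ, ∃ c : ℝ, ∀ y, (y, t) ∈ D → G (y, t) - F (y, t) = c := by
    intro t
    have hd : ∀ y ∈ {y | (y, t) ∈ D}, HasFDerivAt (fun y => G (y, t) - F (y, t))
        (0 : PhaseSpace n →L[ℝ] ℝ) y := by
      intro y hy
      have := (hasFDerivAt_slice (hGd (y, t) hy)).sub (hasFDerivAt_slice (hFd (y, t) hy))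
      rwa [hall _ hy, sub_self] at this
    exact IsOpen.exists_is_const_of_fderiv_eq_zero
      (hD.preimage (by fun_prop : Continuous fun y : PhaseSpace n => (y, t))) (hconn t)
      (fun y hy => (hd y hy).differentiableAt.differentiableWithinAt)
      (fun y hy => (hd y hy).fderiv)
  choose c hc using hslice
  exact ⟨c, fun y t hz => by linarith [hc t y hz]⟩

/-- Existence of the modified Hamiltonian, its uniqueness, and the Hamilton-Jacobi equation. -/
theorem exists_modifiedHamiltonian (c : ℝ) {H : PhaseSpace n → ℝ} (hH : ContDiff ℝ ∞ H) :
    ∃ (W D : Set (PhaseSpace n × ℝ)) (Hhat : PhaseSpace n → ℝ → ℝ),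
      IsSchemeDomain (stagePoint c) H W D ∧
      ((∃ K, LipschitzWith K (hamVec H)) →
        ∃ ε : ℝ, 0 < ε ∧ W = Set.univ ×ˢ Set.Ioo (-ε) ε ∧ D = Set.univ ×ˢ Set.Ioo (-ε) ε) ∧
      IsModifiedHamiltonian (stagePoint c) H W D Hhat ∧
      (∀ G : PhaseSpace n → ℝ → ℝ, IsModifiedHamiltonian (stagePoint c) H W D G →
        ∃ c : ℝ → ℝ, ∀ y t, (y, t) ∈ D → G y t = Hhat y t + c t) ∧
      (∀ y t, (y, t) ∈ D → HasDerivAt (fun τ : ℝ => τ * Hhat y τ)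
        (H (hamiltonJacobiPoint c (fun x => Hhat x t) t y)) t) ∧
      (∀ y h, (y, h) ∈ D → h * Hhat y h =
        ∫ t in (0 : ℝ)..h, H (hamiltonJacobiPoint c (fun x => Hhat x t) t y)) := by
  set f := hamMap H hH with hf
  obtain ⟨D, Γ, hD, hD0, hord, hconn, hΓ, heq, hWo, hLip⟩ :=
    exists_stage_paths (stageMap n c) f (contDiff_hamVec hH)
  have hflow : ∀ z ∈ D, FlowsTo H z.2 (Γ z 0) (Γ z 1) := fun z hz =>
    exists_curve_of_eq_primitive f ((eq_stagePrimitive_iff _ _ _ _ _).1 (heq z hz)).1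
  have hstage : ∀ z ∈ D, stagePoint c (Γ z 0) (Γ z 1) = z.1 := fun z hz =>
    ((eq_stagePrimitive_iff _ _ _ _ _).1 (heq z hz)).2
  have huniq : ∀ {t y₀ y₁ y₁'}, FlowsTo H t y₀ y₁ → FlowsTo H t y₀ y₁' → y₁ = y₁' := by
    rintro t y₀ y₁ y₁' ⟨γ₁, h1, rfl, h1'⟩ ⟨γ₂, h2, rfl, h2'⟩
    exact curve_unique ((contDiff_hamVec hH).of_le (by simp)) (h1.trans h2.symm) h1' h2'
  set d : PhaseSpace n × ℝ → PhaseSpace n :=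
    fun z => pathIntegral _ (superposition f (Γ z)) with hd
  have hΓ0 : ∀ z ∈ D, Γ z 0 = z.1 + z.2 • (0 - stageMap n c (d z)) := fun z hz => by
    have := DFunLike.congr_fun (heq z hz) 0
    rwa [ContinuousMap.add_apply, ContinuousMap.smul_apply, stagePrimitive_apply,
      primitive_apply_zero, constCLM_apply] at this
  have hΓ1 : ∀ z ∈ D, Γ z 1 = z.1 + z.2 • (d z - stageMap n c (d z)) := fun z hz => by
    have := DFunLike.congr_fun (heq z hz) 1
    rwa [ContinuousMap.add_apply, ContinuousMap.smul_apply, stagePrimitive_apply,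
      primitive_one_eq_pathIntegral, constCLM_apply] at this
  have hdiff : ∀ z ∈ D, Γ z 1 - Γ z 0 = z.2 • d z := fun z hz => by
    rw [hΓ0 z hz, hΓ1 z hz]; module
  have hMs : ContDiffOn ℝ ∞ (modifiedHam hH Γ) D := contDiffOn_modifiedHam hH hΓ
  have hMd : ∀ z ∈ D, DifferentiableAt ℝ (modifiedHam hH Γ) z := fun z hz =>
    (hMs.contDiffAt (hD.mem_nhds hz)).differentiableAt (by simp)
  have hkey := fun z (hz : z ∈ D) w => fderiv_mul_modifiedHam hH hD hΓ heq hz w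
  have hham : ∀ z ∈ D, z.2 ≠ 0 → hamVec (fun y => modifiedHam hH Γ (y, z.2)) z.1 = d z := by
    intro z hz hz2
    have h1 := hasFDerivAt_slice (hMd z hz)
    rw [hamVec_eq_symplDual h1.differentiableAt, h1.fderiv]
    have : fderiv ℝ (modifiedHam hH Γ) z ∘L .inl ℝ _ _ = sympl n (d z) := by
      refine ContinuousLinearMap.ext fun v => ?_
      have := hkey z hz (v, 0)
      simp only [zero_mul, zero_add] at this
      exact mul_left_cancel₀ hz2 this
    rw [this, symplDual_sympl]
  -- The argument of H is the endpoint y₁. At t = 0 the prefactor t makes this hold without knowing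
  -- the gradient of Ĥ there.
  have hpoint : ∀ z ∈ D,
      hamiltonJacobiPoint c (fun y => modifiedHam hH Γ (y, z.2)) z.2 z.1 = Γ z 1 := by
    intro z hz
    rw [hΓ1 z hz, hamiltonJacobiPoint]
    rcases eq_or_ne z.2 0 with h0 | h0
    · rw [h0, zero_smul, zero_smul]
    · rw [hham z hz h0]
  have hHJ : ∀ y t, (y, t) ∈ D → HasDerivAt (fun τ : ℝ => τ * modifiedHam hH Γ (y, τ))
      (H (hamiltonJacobiPoint c (fun x => modifiedHam hH Γ (x, t)) t y)) t := by
    intro y t hz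
    have h1 := (hasDerivAt_id t).mul (hasDerivAt_time (hMd (y, t) hz))
    refine h1.congr_deriv ?_
    have h2 := hkey (y, t) hz (0, 1)
    simp only [map_zero, mul_zero, add_zero, one_mul] at h2
    rw [hpoint (y, t) hz, ← h2, one_mul]
    rfl
  -- W consists of the initial values of the paths in the family. Injectivity holds because an
  -- initial value and a time determine the endpoint, hence the evaluation point.
  refine ⟨(fun z : PhaseSpace n × ℝ => (Γ z 0, z.2)) '' D, D, fun y t => modifiedHam hH Γ (y, t),
    ⟨hWo, ?_, hD, hD0, hord, hconn, ?_, ?_⟩, hLip, ⟨hMs, ?_⟩, ?_, hHJ, ?_⟩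
  · intro y
    refine ⟨(y, 0), hD0 y, ?_⟩
    simp [hΓ0 _ (hD0 y)]
  · rintro _ _ ⟨z, hz, heq⟩
    obtain ⟨rfl, rfl⟩ := Prod.mk.inj heq
    exact ⟨Γ z 1, hflow z hz, by rw [hstage z hz]; exact hz⟩
  · intro y t hz
    refine ⟨Γ (y, t) 0, ⟨⟨(y, t), hz, rfl⟩, Γ (y, t) 1, hflow _ hz, hstage _ hz⟩, ?_⟩
    rintro y₀ ⟨⟨z, hzD, heq⟩, y₁, hfl, hst⟩
    obtain ⟨rfl, rfl⟩ := Prod.mk.inj heq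
    have h1 := huniq hfl (hflow z hzD)
    rw [h1, hstage z hzD] at hst
    rw [← hst]
  · rintro _ _ ⟨z, hz, heq⟩ ht y₁ hfl
    obtain ⟨rfl, rfl⟩ := Prod.mk.inj heq
    rw [huniq hfl (hflow z hz), hstage z hz, hdiff z hz, hham z hz ht, smul_smul,
      inv_mul_cancel₀ ht, one_smul]
  · intro G hG
    refine eq_add_of_hamVec_eq (G := fun z => G z.1 z.2) hD hconn hMs hG.smooth
      fun y t hz ht => ?_
    have h1 := hG.hamVec_eq (Γ (y, t) 0) t ⟨(y, t), hz, rfl⟩ ht (Γ (y, t) 1) (hflow _ hz)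
    rw [hstage _ hz, hdiff _ hz, smul_smul, inv_mul_cancel₀ ht, one_smul] at h1
    exact h1.trans (hham _ hz ht).symm
  · intro y h hz
    have hmem : ∀ t ∈ Set.uIcc 0 h, (y, t) ∈ D := fun t ht =>
      (hord y).uIcc_subset (hD0 y) hz ht
    have hcont : ContinuousOn
        (fun t => H (hamiltonJacobiPoint c (fun x => modifiedHam hH Γ (x, t)) t y))
        (Set.uIcc 0 h) := by
      have h1 : ContinuousOn (fun t : ℝ => H (Γ (y, t) 1)) (Set.uIcc 0 h) :=
        hH.continuous.comp_continuousOn ((ContinuousMap.evalCLM ℝ 1).continuous.comp_continuousOn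
          (hΓ.continuousOn.comp (by fun_prop) hmem))
      exact h1.congr fun t ht => congrArg H (hpoint (y, t) (hmem t ht))
    rw [intervalIntegral.integral_eq_sub_of_hasDerivAt (fun t ht => hHJ y t (hmem t ht))
      hcont.intervalIntegrable]
    simp

end Scheme

/-! ### Universal polynomials for the formal coefficients -/

section Universal

open MvPolynomial

/-- When the variables evolve by polynomial velocities δ, time differentiation becomes a derivation
of the polynomial ring and can be iterated there. -/
theorem hasDerivAt_aeval {σ : Type*} (x : ℝ → σ → ℝ) (δ : σ → MvPolynomial σ ℚ) {t : ℝ}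
    (h : ∀ i, HasDerivAt (fun s => x s i) (aeval (x t) (δ i)) t) (p : MvPolynomial σ ℚ) :
    HasDerivAt (fun s => aeval (x s) p) (aeval (x t) (mkDerivation ℚ δ p)) t := by
  induction p using MvPolynomial.induction_on with
  | C a => simpa using hasDerivAt_const t (a : ℝ)
  | add p q hp hq =>
    simp only [map_add]
    exact hp.add hq
  | mul_X p i hp =>
    have h1 := hp.mul (h i)
    simp only [map_mul, aeval_X, Derivation.leibniz, mkDerivation_X, smul_eq_mul, map_add]
    exact h1.congr_deriv (by ring)

theorem contDiff_aeval {σ E : Type*} [NormedAddCommGroup E] [NormedSpace ℝ E] (x : E → σ → ℝ)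
    (h : ∀ i, ContDiff ℝ ∞ fun y => x y i) (p : MvPolynomial σ ℚ) :
    ContDiff ℝ ∞ fun y => aeval (x y) p := by
  induction p using MvPolynomial.induction_on with
  | C a => simpa using contDiff_const
  | add p q hp hq =>
    simp only [map_add]
    exact hp.add hq
  | mul_X p i hp =>
    simp only [map_mul, aeval_X]
    exact hp.mul (h i)

variable {n : ℕ}

theorem contDiff_partialDerivs {H : PhaseSpace n → ℝ} (hH : ContDiff ℝ ∞ H)
    (l : List (Fin n ⊕ Fin n)) : ContDiff ℝ ∞ (partialDerivs H l) := by
  induction l with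
  | nil => exact hH
  | cons i l ih => exact (contDiff_infty_iff_fderiv.1 ih).2.clm_apply contDiff_const

/-- The formal partial derivative of a polynomial in the partial derivatives of a function. -/
def formalPartial (a : Fin n ⊕ Fin n) :
    Derivation ℚ (MvPolynomial (List (Fin n ⊕ Fin n)) ℚ) (MvPolynomial (List (Fin n ⊕ Fin n)) ℚ) :=
  mkDerivation ℚ fun l => X (a :: l)

theorem fderiv_aeval_partialDerivs {H : PhaseSpace n → ℝ} (hH : ContDiff ℝ ∞ H)
    (a : Fin n ⊕ Fin n) (p : MvPolynomial (List (Fin n ⊕ Fin n)) ℚ) (y : PhaseSpace n) :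
    fderiv ℝ (fun y => aeval (fun l => partialDerivs H l y) p) y (coordVec a) =
      aeval (fun l => partialDerivs H l y) (formalPartial a p) := by
  have hline : HasDerivAt (fun s : ℝ => y + s • coordVec a) (coordVec a) 0 := by
    simpa using ((hasDerivAt_id (0 : ℝ)).smul_const (coordVec a)).const_add y
  have hcomp : ∀ F : PhaseSpace n → ℝ, ContDiff ℝ ∞ F →
      HasDerivAt (fun s : ℝ => F (y + s • coordVec a)) (fderiv ℝ F y (coordVec a)) 0 := by
    intro F hF
    have hd : HasFDerivAt F (fderiv ℝ F y) (y + (0 : ℝ) • coordVec a) := by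
      rw [zero_smul, add_zero]
      exact (hF.differentiable (by simp) y).hasFDerivAt
    exact hd.comp_hasDerivAt 0 hline
  have h1 := hcomp _ (contDiff_aeval (fun y l => partialDerivs H l y)
    (fun l => contDiff_partialDerivs hH l) p)
  have h2 := hasDerivAt_aeval (fun s l => partialDerivs H l (y + s • coordVec a))
    (fun l => X (a :: l)) (t := 0) (fun l => by
      simpa [partialDerivs] using hcomp _ (contDiff_partialDerivs hH l)) p
  rw [h1.unique h2]
  simp [formalPartial]

/-- The weights of the partial derivatives of `F` in `(1 - L) J⁻¹ ∇F`. -/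
def stageWeight (n : ℕ) (c : ℚ) : Fin n ⊕ Fin n → ℚ := Sum.elim (fun _ => c - 1) fun _ => c

theorem phaseSpace_eq_sum (v : PhaseSpace n) :
    v = ∑ i, v.1 i • coordVec (Sum.inl i) + ∑ i, v.2 i • coordVec (Sum.inr i) := by
  have h : ∀ u : EuclideanSpace ℝ (Fin n), u = ∑ i, u i • EuclideanSpace.single i (1 : ℝ) := by
    intro u
    conv_lhs => rw [← (EuclideanSpace.basisFun (Fin n) ℝ).sum_repr u]
    simp
  refine Prod.ext ?_ ?_
  · simpa [Prod.fst_sum, coordVec] using h v.1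
  · simpa [Prod.snd_sum, coordVec] using h v.2

/-- The field exchanges p and q, hence `a.swap`; its sign -1 on the p-components turns the weight 1
- c into c - 1. -/
theorem hamVec_sub_stageMap_eq_sum (c : ℚ) {F : PhaseSpace n → ℝ} {y : PhaseSpace n}
    (hF : DifferentiableAt ℝ F y) :
    hamVec F y - stageMap n c (hamVec F y) =
      ∑ a, ((stageWeight n c a : ℝ) * fderiv ℝ F y (coordVec a.swap)) • coordVec a := by
  have hp : ∀ i, fderiv ℝ F y (coordVec (Sum.inl i)) = (hamVec F y).2 i := fun i => by
    rw [fderiv_eq_sympl_hamVec hF, sympl_apply]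
    simp [coordVec, PiLp.inner_apply]
  have hq : ∀ i, fderiv ℝ F y (coordVec (Sum.inr i)) = -(hamVec F y).1 i := fun i => by
    rw [fderiv_eq_sympl_hamVec hF, sympl_apply]
    simp [coordVec, PiLp.inner_apply]
  rw [Fintype.sum_sum_type, phaseSpace_eq_sum (hamVec F y - stageMap n c (hamVec F y))]
  congr 1
  · refine Finset.sum_congr rfl fun i _ => ?_
    rw [Sum.swap_inl, hq]
    congr 1
    simp [stageMap_apply, stageWeight]
    ring
  · refine Finset.sum_congr rfl fun i _ => ?_
    rw [Sum.swap_inr, hp]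
    congr 1
    simp [stageMap_apply, stageWeight]
    ring

variable {k : ℕ}

/-- The displacement in direction `a` of the argument of `H` in the Hamilton-Jacobi equation, for
the truncated series with coefficients `Q`; `none` stands for the time. -/
def displacementPoly (c : ℚ) (Q : Fin k → MvPolynomial (List (Fin n ⊕ Fin n)) ℚ)
    (a : Fin n ⊕ Fin n) : MvPolynomial (Option (List (Fin n ⊕ Fin n))) ℚ :=
  -- The exponent exceeds j by one because the argument of H carries its own factor t.
  ∑ j : Fin k, C (stageWeight n c a) * X none ^ ((j : ℕ) + 1) *
    rename some (formalPartial a.swap (Q j))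

/-- The time derivative of the displacement. -/
def velocityPoly (c : ℚ) (Q : Fin k → MvPolynomial (List (Fin n ⊕ Fin n)) ℚ)
    (a : Fin n ⊕ Fin n) : MvPolynomial (Option (List (Fin n ⊕ Fin n))) ℚ :=
  mkDerivation ℚ (fun v => v.elim 1 fun _ => 0) (displacementPoly c Q a)

/-- The formal time derivative along the argument of `H`: the variables `inl l` are partial
derivatives of `H` at the moving argument, `inr (some l)` those at the base point, and `inr none`
is the time. -/
def formalTimeDeriv (c : ℚ) (Q : Fin k → MvPolynomial (List (Fin n ⊕ Fin n)) ℚ) :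
    Derivation ℚ (MvPolynomial (List (Fin n ⊕ Fin n) ⊕ Option (List (Fin n ⊕ Fin n))) ℚ)
      (MvPolynomial (List (Fin n ⊕ Fin n) ⊕ Option (List (Fin n ⊕ Fin n))) ℚ) :=
  mkDerivation ℚ (Sum.elim
    (fun l => ∑ a, X (Sum.inl (a :: l)) * rename Sum.inr (velocityPoly c Q a))
    fun v => v.elim 1 fun _ => 0)

/-- The next coefficient of the formal series, as a polynomial in partial derivatives. -/
def nextCoeffPoly (c : ℚ) (Q : Fin k → MvPolynomial (List (Fin n ⊕ Fin n)) ℚ) :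
    MvPolynomial (List (Fin n ⊕ Fin n)) ℚ :=
  C (1 / ((k : ℚ) + 1) * (1 / (k.factorial : ℚ))) *
    -- Evaluation at t = 0: the time becomes 0, and the moving and base points coincide, so both
    -- families of variables become the same X.
    aeval (Sum.elim X fun v => v.elim 0 X) ((formalTimeDeriv c Q)^[k] (X (Sum.inl [])))

/-- Following all partial derivatives of H at the moving point, together with the time and the
frozen base values, gives a closed system with polynomial velocities; m time derivatives are then m
applications of one derivation. -/
theorem iteratedDeriv_along_displacement (c : ℚ) {H : PhaseSpace n → ℝ} (hH : ContDiff ℝ ∞ H)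
    (Q : Fin k → MvPolynomial (List (Fin n ⊕ Fin n)) ℚ) (y : PhaseSpace n) (m : ℕ) :
    iteratedDeriv m (fun t : ℝ => H (y + ∑ a, aeval (fun v : Option (List (Fin n ⊕ Fin n)) =>
        v.elim t fun l => partialDerivs H l y) (displacementPoly c Q a) • coordVec a)) 0 =
      aeval (fun l => partialDerivs H l y)
        (aeval (Sum.elim X fun v => v.elim 0 X : _ → MvPolynomial (List (Fin n ⊕ Fin n)) ℚ)
          ((formalTimeDeriv c Q)^[m] (X (Sum.inl [])))) := by
  set val₀ : ℝ → Option (List (Fin n ⊕ Fin n)) → ℝ :=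
    fun t v => v.elim t fun l => partialDerivs H l y with hval₀
  set x : ℝ → PhaseSpace n :=
    fun t => y + ∑ a, aeval (val₀ t) (displacementPoly c Q a) • coordVec a with hx
  set val : ℝ → List (Fin n ⊕ Fin n) ⊕ Option (List (Fin n ⊕ Fin n)) → ℝ :=
    fun t => Sum.elim (fun l => partialDerivs H l (x t)) (val₀ t) with hval
  have hval₀d : ∀ t v, HasDerivAt (fun s => val₀ s v)
      (aeval (val₀ t) ((v.elim 1 fun _ => 0 : MvPolynomial _ ℚ))) t := by
    rintro t (_ | l)
    · simpa [hval₀] using hasDerivAt_id' t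
    · simpa [hval₀] using hasDerivAt_const t (partialDerivs H l y)
  have hxd : ∀ t, HasDerivAt x (∑ a, aeval (val₀ t) (velocityPoly c Q a) • coordVec a) t := by
    intro t
    exact (HasDerivAt.fun_sum fun a _ => (hasDerivAt_aeval val₀ _ (hval₀d t)
      (displacementPoly c Q a)).smul_const (coordVec a)).const_add y
  have hvald : ∀ t v, HasDerivAt (fun s => val s v) (aeval (val t)
      ((Sum.elim (fun l => ∑ a, X (Sum.inl (a :: l)) * rename Sum.inr (velocityPoly c Q a))
        fun v => v.elim 1 fun _ => 0 :
        List (Fin n ⊕ Fin n) ⊕ Option (List (Fin n ⊕ Fin n)) → MvPolynomial _ ℚ) v)) t := by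
    rintro t (l | v)
    · have h1 := ((contDiff_partialDerivs hH l).differentiable (by simp)
        (x t)).hasFDerivAt.comp_hasDerivAt t (hxd t)
      refine h1.congr_deriv ?_
      simp only [Sum.elim_inl, map_sum, map_mul, aeval_X, aeval_rename, map_smul, smul_eq_mul]
      refine Finset.sum_congr rfl fun a _ => ?_
      rw [mul_comm]
      rfl
    · refine (hval₀d t v).congr_deriv ?_
      rcases v with _ | l <;> simp
  have hiter : ∀ m, iteratedDeriv m
      (fun t => aeval (val t) (X (Sum.inl []) : MvPolynomial _ ℚ)) =
        fun t => aeval (val t) ((formalTimeDeriv c Q)^[m] (X (Sum.inl []))) := by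
    intro m
    induction m with
    | zero => simp
    | succ m ih =>
      rw [iteratedDeriv_succ, ih]
      funext t
      rw [Function.iterate_succ_apply']
      exact (hasDerivAt_aeval val _ (hvald t) _).deriv
  have hH0 : (fun t : ℝ => H (x t)) = fun t => aeval (val t) (X (Sum.inl []) : MvPolynomial _ ℚ) := by
    funext t
    simp [hval, partialDerivs]
  rw [hH0, hiter]
  have hx0 : x 0 = y := by
    have : ∀ a, aeval (val₀ 0) (displacementPoly c Q a) = 0 := by
      intro a
      simp [displacementPoly, hval₀]
    simp [hx, this]
  simp only
  rw [← AlgHom.comp_apply, comp_aeval]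
  congr 2
  funext v
  rcases v with l | _ | l
  · simp [hval, hx0]
  · simp [hval, hval₀]
  · simp [hval, hval₀]

/-- The coefficients of the formal series are universal polynomials in the partial derivatives
of the Hamiltonian. -/
theorem exists_formalCoeff_eq_aeval (n : ℕ) (c : ℚ) :
    ∃ P : ℕ → MvPolynomial (List (Fin n ⊕ Fin n)) ℚ, ∀ H : PhaseSpace n → ℝ, ContDiff ℝ ∞ H →
      ∀ k y, formalCoeff (hamiltonJacobiPoint c) H k y =
        aeval (fun l => partialDerivs H l y) (P k) := by
  have key : ∀ k : ℕ, ∃ P : MvPolynomial (List (Fin n ⊕ Fin n)) ℚ, ∀ H : PhaseSpace n → ℝ,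
      ContDiff ℝ ∞ H → ∀ y, formalCoeff (hamiltonJacobiPoint c) H k y =
        aeval (fun l => partialDerivs H l y) P := by
    intro k
    induction k using Nat.strong_induction_on with
    | _ k ih =>
    -- The earlier polynomials are fixed before H is introduced, which keeps the next one
    -- independent of H.
    choose P hP using ih
    set Q : Fin k → MvPolynomial (List (Fin n ⊕ Fin n)) ℚ := fun j => P j j.2 with hQ
    refine ⟨nextCoeffPoly c Q, fun H hH y => ?_⟩
    have hQs : ∀ j : Fin k, ContDiff ℝ ∞ fun x => aeval (fun l => partialDerivs H l x) (Q j) :=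
      fun j => contDiff_aeval _ (fun l => contDiff_partialDerivs hH l) _
    rw [formalCoeff]
    have hpt : ∀ t : ℝ, hamiltonJacobiPoint c (fun x => ∑ j : Fin k, t ^ (j : ℕ) *
        formalCoeff (hamiltonJacobiPoint c) H j x) t y =
        y + ∑ a, aeval (fun v : Option (List (Fin n ⊕ Fin n)) =>
        v.elim t fun l => partialDerivs H l y) (displacementPoly c Q a) • coordVec a := by
      intro t
      have hfun : (fun x => ∑ j : Fin k, t ^ (j : ℕ) *
          formalCoeff (hamiltonJacobiPoint c) H j x) =
          fun x => ∑ j : Fin k, t ^ (j : ℕ) * aeval (fun l => partialDerivs H l x) (Q j) := by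
        funext x
        exact Finset.sum_congr rfl fun j _ => by rw [hP j j.2 H hH x]
      have hd : HasFDerivAt
          (fun x => ∑ j : Fin k, t ^ (j : ℕ) * aeval (fun l => partialDerivs H l x) (Q j))
          (∑ j : Fin k, t ^ (j : ℕ) •
            fderiv ℝ (fun x => aeval (fun l => partialDerivs H l x) (Q j)) y) y :=
        HasFDerivAt.fun_sum fun j _ =>
          (((hQs j).differentiable (by simp) y).hasFDerivAt.const_mul _)
      rw [hfun, hamiltonJacobiPoint, hamVec_sub_stageMap_eq_sum c hd.differentiableAt, hd.fderiv,
        Finset.smul_sum]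
      congr 1
      refine Finset.sum_congr rfl fun a _ => ?_
      rw [smul_smul]
      congr 1
      simp only [sum_apply, smul_apply, smul_eq_mul,
        fderiv_aeval_partialDerivs hH, displacementPoly, map_sum, map_mul, map_pow, aeval_X,
        aeval_rename, aeval_C, Option.elim_none, Finset.mul_sum, Function.comp_def,
        Option.elim_some]
      refine Finset.sum_congr rfl fun j _ => ?_
      simp only [eq_ratCast]
      ring
    simp only [hpt]
    rw [iteratedDeriv_along_displacement c hH Q y k, nextCoeffPoly, map_mul, aeval_C]
    simp only [eq_ratCast]
    push_cast
    ring
  choose P hP using key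
  exact ⟨P, fun H hH k y => hP k H hH y⟩

end Universal

/-! ### Taylor expansion and jets of curves -/

section Taylor

variable {E V : Type*} [NormedAddCommGroup E] [NormedSpace ℝ E]
  [NormedAddCommGroup V] [NormedSpace ℝ V]

/-- Taylor's formula of order N with o(h^N) remainder; the term of order N is absorbed into O(h^N).
-/
theorem taylor_isBigO {f : ℝ → ℝ} {U : Set ℝ} (hU : IsOpen U) (h0 : (0 : ℝ) ∈ U)
    (hf : ContDiffOn ℝ ∞ f U) (N : ℕ) :
    (fun h : ℝ => f h - ∑ k ∈ Finset.range N, h ^ k * (iteratedDeriv k f 0 / k.factorial))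
      =O[𝓝 0] fun h : ℝ => h ^ N := by
  obtain ⟨δ, hδ, hball⟩ := Metric.isOpen_iff.1 hU 0 h0
  have hlo := taylor_isLittleO (n := N) (convex_ball (0 : ℝ) δ) (Metric.mem_ball_self hδ)
    ((hf.mono hball).of_le (mod_cast le_top))
  rw [Metric.isOpen_ball.nhdsWithin_eq (Metric.mem_ball_self hδ)] at hlo
  simp only [sub_zero] at hlo
  have hT : ∀ h : ℝ, taylorWithinEval f N (Metric.ball 0 δ) 0 h =
      ∑ k ∈ Finset.range N, h ^ k * (iteratedDeriv k f 0 / k.factorial) +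
        h ^ N * (iteratedDeriv N f 0 / N.factorial) := by
    intro h
    rw [taylor_within_apply, Finset.sum_range_succ]
    have hterm : ∀ k : ℕ, ((k.factorial : ℝ)⁻¹ * (h - 0) ^ k) •
        iteratedDerivWithin k f (Metric.ball 0 δ) 0 =
        h ^ k * (iteratedDeriv k f 0 / k.factorial) := by
      intro k
      rw [iteratedDerivWithin_of_isOpen Metric.isOpen_ball (Metric.mem_ball_self hδ), smul_eq_mul,
        sub_zero]
      ring
    simp only [hterm]
  have hlast : (fun h : ℝ => h ^ N * (iteratedDeriv N f 0 / N.factorial))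
      =O[𝓝 0] fun h : ℝ => h ^ N := by
    simpa [mul_comm] using (Asymptotics.isBigO_refl (fun h : ℝ => h ^ N) (𝓝 0)).const_mul_left
      (iteratedDeriv N f 0 / N.factorial)
  refine (hlo.isBigO.add hlast).congr_left fun h => ?_
  rw [hT h]
  ring

theorem iteratedDeriv_clm_comp {f : ℝ → E} {x : ℝ} {k : ℕ} (T : E →L[ℝ] V)
    (hf : ContDiffAt ℝ k f x) :
    iteratedDeriv k (fun t => T (f t)) x = T (iteratedDeriv k f x) := by
  have := T.iteratedFDeriv_comp_left hf le_rfl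
  rw [iteratedDeriv_eq_iteratedFDeriv, iteratedDeriv_eq_iteratedFDeriv]
  exact DFunLike.congr_fun this _

/-- In the Leibniz formula only the first derivative of t is nonzero at 0. -/
theorem iteratedDeriv_id_smul_zero {f : ℝ → V} {k : ℕ}
    (hf : ContDiffAt ℝ ((k + 1 : ℕ) : ℕ∞ω) f 0) :
    iteratedDeriv (k + 1) (fun t => t • f t) 0 = (k + 1 : ℝ) • iteratedDeriv k f 0 := by
  have h := iteratedDerivWithin_smul (𝕜 := ℝ) (n := k + 1) (f := fun t : ℝ => t) (g := f)
    (Set.mem_univ (0 : ℝ)) uniqueDiffOn_univ contDiffAt_id.contDiffWithinAt hf.contDiffWithinAt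
  simp only [iteratedDerivWithin_univ] at h
  change iteratedDeriv (k + 1) ((fun t : ℝ => t) • f) 0 = _
  rw [h, Finset.sum_eq_single 1]
  · rw [iteratedDeriv_fun_id_zero, if_pos rfl, one_smul, Nat.choose_one_right,
      Nat.add_sub_cancel, ← Nat.cast_smul_eq_nsmul ℝ]
    push_cast
    rfl
  · intro i _ hi
    rw [iteratedDeriv_fun_id_zero, if_neg hi, zero_smul, smul_zero]
  · intro h1
    exact absurd (Finset.mem_range.2 (by omega)) h1

/-- The `k`-jet of a composition depends only on the `k`-jet of the inner curve. -/
theorem iteratedDeriv_comp_congr {g : E → V} {f₁ f₂ : ℝ → E} {k : ℕ} (hg : ContDiff ℝ ∞ g)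
    (h₁ : ContDiffAt ℝ k f₁ 0) (h₂ : ContDiffAt ℝ k f₂ 0)
    (h : ∀ i ≤ k, iteratedDeriv i f₁ 0 = iteratedDeriv i f₂ 0) :
    iteratedDeriv k (fun t => g (f₁ t)) 0 = iteratedDeriv k (fun t => g (f₂ t)) 0 := by
  have hgk : ContDiff ℝ k g := hg.of_le (mod_cast le_top)
  have h0 : f₁ 0 = f₂ 0 := by simpa using h 0 (Nat.zero_le k)
  -- Faà di Bruno: every block of a partition of k elements has size at most k.
  have e1 := iteratedDeriv_vcomp_eq_sum_orderedFinpartition (i := k) hgk.contDiffAt h₁ le_rfl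
  have e2 := iteratedDeriv_vcomp_eq_sum_orderedFinpartition (i := k) hgk.contDiffAt h₂ le_rfl
  change iteratedDeriv k (g ∘ f₁) 0 = iteratedDeriv k (g ∘ f₂) 0
  rw [e1, e2, h0]
  refine Finset.sum_congr rfl fun c _ => ?_
  congr 1
  funext j
  exact h _ (c.partSize_le j)

/-- Derivatives in time commute with the derivative in space. -/
theorem iteratedDeriv_fderiv_comm {D : Set (E × ℝ)} (hD : IsOpen D)
    (hD0 : ∀ y, (y, (0 : ℝ)) ∈ D) (k : ℕ) : ∀ {F : E × ℝ → ℝ}, ContDiffOn ℝ ∞ F D → ∀ y : E,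
      iteratedDeriv k (fun t => fderiv ℝ F (y, t) ∘L .inl ℝ E ℝ) 0 =
        fderiv ℝ (fun x => iteratedDeriv k (fun t => F (x, t)) 0) y := by
  induction k with
  | zero =>
    intro F hF y
    have hd := ((hF.contDiffAt (hD.mem_nhds (hD0 y))).differentiableAt (by simp)).hasFDerivAt
    have := HasFDerivAt.comp y (g := F) (f := fun y => (y, (0 : ℝ))) hd
      (hasFDerivAt_prodMk_left y 0)
    simp only [iteratedDeriv_zero]
    exact this.fderiv.symm
  | succ k ih =>
    intro F hF y
    have hF' : ContDiffOn ℝ ∞ (fderiv ℝ F) D := hF.fderiv_of_isOpen hD (by simp)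
    set G : E × ℝ → ℝ := fun z => fderiv ℝ F z (0, 1) with hG
    have hGs : ContDiffOn ℝ ∞ G D := hF'.clm_apply contDiffOn_const
    have hev : ∀ x : E, ∀ᶠ t in 𝓝 (0 : ℝ), (x, t) ∈ D := fun x =>
      (by fun_prop : ContinuousAt (fun t : ℝ => (x, t)) 0) (hD.mem_nhds (hD0 x))
    have h1 : ∀ x : E, iteratedDeriv (k + 1) (fun t => F (x, t)) 0 =
        iteratedDeriv k (fun t => G (x, t)) 0 := by
      intro x
      rw [iteratedDeriv_succ']
      refine Filter.EventuallyEq.iteratedDeriv_eq k ?_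
      filter_upwards [hev x] with t ht
      have hd := ((hF.contDiffAt (hD.mem_nhds ht)).differentiableAt (by simp)).hasFDerivAt
      have := (HasFDerivAt.comp t (g := F) (f := fun t => (x, t)) hd
        (hasFDerivAt_prodMk_right x t)).hasDerivAt.deriv
      exact this.trans (by simp [hG])
    simp only [h1]
    -- The induction hypothesis applies to G = ∂ₜF; what remains is symmetry of the second
    -- derivative of F.
    rw [← ih hGs y, iteratedDeriv_succ']
    refine Filter.EventuallyEq.iteratedDeriv_eq k ?_
    filter_upwards [hev y] with t ht
    have hFat := hF.contDiffAt (hD.mem_nhds ht)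
    have hd := ((hF'.contDiffAt (hD.mem_nhds ht)).differentiableAt (by simp)).hasFDerivAt
    have hsymm : IsSymmSndFDerivAt ℝ F (y, t) :=
      hFat.isSymmSndFDerivAt (by
        rw [minSmoothness_of_isRCLikeNormedField]
        exact WithTop.coe_le_coe.2 (le_top : (2 : ℕ∞) ≤ ⊤))
    have hline : HasDerivAt (fun t => fderiv ℝ F (y, t))
        (fderiv ℝ (fderiv ℝ F) (y, t) (0, 1)) t :=
      (HasFDerivAt.comp t (g := fderiv ℝ F) (f := fun t => (y, t)) hd
        (hasFDerivAt_prodMk_right y t)).hasDerivAt.congr_deriv (by simp)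
    have hleft : HasDerivAt (fun t => fderiv ℝ F (y, t) ∘L .inl ℝ E ℝ)
        (fderiv ℝ (fderiv ℝ F) (y, t) (0, 1) ∘L .inl ℝ E ℝ) t := by
      simpa using hline.clm_comp (hasDerivAt_const t (ContinuousLinearMap.inl ℝ E ℝ))
    rw [hleft.deriv]
    have hGd : HasFDerivAt G ((fderiv ℝ (fderiv ℝ F) (y, t)).flip (0, 1)) (y, t) := by
      have := hd.clm_apply (hasFDerivAt_const ((0, 1) : E × ℝ) (y, t))
      simpa using this
    rw [hGd.fderiv]
    refine ContinuousLinearMap.ext fun v => ?_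
    exact hsymm.eq _ _

end Taylor

/-! ### The formal series is the Taylor expansion -/

section Expansion

variable {n : ℕ}

/-- The time derivatives at `0` of a smooth solution of the Hamilton-Jacobi equation are given by
the formal series. -/
theorem iteratedDeriv_eq_formalCoeff (c : ℚ) {H : PhaseSpace n → ℝ} (hH : ContDiff ℝ ∞ H)
    {D : Set (PhaseSpace n × ℝ)} (hD : IsOpen D) (hD0 : ∀ y, (y, (0 : ℝ)) ∈ D)
    {F : PhaseSpace n × ℝ → ℝ} (hF : ContDiffOn ℝ ∞ F D)
    (hHJ : ∀ y t, (y, t) ∈ D → HasDerivAt (fun τ : ℝ => τ * F (y, τ))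
      (H (hamiltonJacobiPoint c (fun x => F (x, t)) t y)) t) (k : ℕ) :
    ∀ y, iteratedDeriv k (fun t => F (y, t)) 0 =
      k.factorial * formalCoeff (hamiltonJacobiPoint c) H k y := by
  obtain ⟨P, hP⟩ := exists_formalCoeff_eq_aeval n c
  have hcs : ∀ j, ContDiff ℝ ∞ (formalCoeff (hamiltonJacobiPoint c) H j) := fun j => by
    rw [funext (hP H hH j)]
    exact contDiff_aeval _ (fun l => contDiff_partialDerivs hH l) _
  induction k using Nat.strong_induction_on with
  | _ k ih =>
  intro y
  set T : (PhaseSpace n →L[ℝ] ℝ) →L[ℝ] PhaseSpace n :=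
    (.id ℝ _ - stageMap n c) ∘L symplDual n with hT
  set ℓ₁ : ℝ → PhaseSpace n →L[ℝ] ℝ := fun t => fderiv ℝ F (y, t) ∘L .inl ℝ _ ℝ with hℓ₁
  set ℓ₂ : ℝ → PhaseSpace n →L[ℝ] ℝ := fun t => ∑ j : Fin k, t ^ (j : ℕ) •
    fderiv ℝ (formalCoeff (hamiltonJacobiPoint c) H j) y with hℓ₂
  have hev : ∀ᶠ t in 𝓝 (0 : ℝ), (y, t) ∈ D :=
    (by fun_prop : ContinuousAt (fun t : ℝ => (y, t)) 0) (hD.mem_nhds (hD0 y))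
  have hline : ContDiff ℝ ∞ fun t : ℝ => (y, t) := contDiff_const.prodMk contDiff_id
  have hFy : ContDiffAt ℝ ∞ (fun t => F (y, t)) 0 :=
    ContDiffAt.comp (g := F) (f := fun t : ℝ => (y, t)) 0 (hF.contDiffAt (hD.mem_nhds (hD0 y)))
      hline.contDiffAt
  have hℓ₁s : ContDiffAt ℝ ∞ ℓ₁ 0 := by
    have h1 : ContDiffAt ℝ ∞ (fun t => fderiv ℝ F (y, t)) 0 :=
      ContDiffAt.comp (g := fderiv ℝ F) (f := fun t : ℝ => (y, t)) 0
        ((hF.fderiv_of_isOpen hD (by simp)).contDiffAt (hD.mem_nhds (hD0 y))) hline.contDiffAt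
    exact h1.clm_comp contDiffAt_const
  have hℓ₂s : ContDiff ℝ ∞ ℓ₂ :=
    ContDiff.sum fun j _ => (contDiff_id.pow _).smul contDiff_const
  have hpt : ∀ (G : PhaseSpace n → ℝ) (t : ℝ), DifferentiableAt ℝ G y →
      hamiltonJacobiPoint c G t y = y + t • T (fderiv ℝ G y) := by
    intro G t hG
    rw [hamiltonJacobiPoint, hamVec_eq_symplDual hG]
    rfl
  have hcurve : ∀ ℓ : ℝ → PhaseSpace n →L[ℝ] ℝ, ContDiffAt ℝ ∞ ℓ 0 →
      ContDiffAt ℝ ∞ (fun t : ℝ => y + t • T (ℓ t)) 0 := fun ℓ hℓ =>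
    contDiffAt_const.add (contDiffAt_id.smul (T.contDiff.contDiffAt.comp 0 hℓ))
  -- The factor t shifts orders by one: the k-jet of the argument needs only derivatives of ℓ of
  -- order below k. Hence the truncation at j < k loses nothing, and strong induction closes.
  have hjet : ∀ ℓ : ℝ → PhaseSpace n →L[ℝ] ℝ, ContDiffAt ℝ ∞ ℓ 0 → ∀ m : ℕ,
      iteratedDeriv (m + 1) (fun t : ℝ => y + t • T (ℓ t)) 0 =
        (m + 1 : ℝ) • T (iteratedDeriv m ℓ 0) := by
    intro ℓ hℓ m
    rw [iteratedDeriv_const_add m.succ_pos, iteratedDeriv_id_smul_zero (f := fun t => T (ℓ t))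
      ((T.contDiff.contDiffAt.comp 0 hℓ).of_le (mod_cast le_top)),
      iteratedDeriv_clm_comp T (hℓ.of_le (mod_cast le_top))]
  have hℓjet : ∀ m < k, iteratedDeriv m ℓ₁ 0 = iteratedDeriv m ℓ₂ 0 := by
    intro m hm
    have h1 : iteratedDeriv m ℓ₁ 0 =
        (m.factorial : ℝ) • fderiv ℝ (formalCoeff (hamiltonJacobiPoint c) H m) y := by
      rw [hℓ₁, iteratedDeriv_fderiv_comm hD hD0 m hF y, funext (ih m hm)]
      exact (((hcs m).differentiable (by simp) y).hasFDerivAt.const_mul _).fderiv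
    have h2 : iteratedDeriv m ℓ₂ 0 =
        (m.factorial : ℝ) • fderiv ℝ (formalCoeff (hamiltonJacobiPoint c) H m) y := by
      rw [hℓ₂, iteratedDeriv_fun_sum fun j _ =>
        ((contDiff_id.pow _).smul contDiff_const).contDiffAt]
      rw [Finset.sum_eq_single (⟨m, hm⟩ : Fin k)]
      · rw [iteratedDeriv_smul_const ((contDiff_id.pow _).contDiffAt)]
        have := iteratedDeriv_fun_pow_zero (𝕜 := ℝ) (n := m) (m := m)
        rw [if_pos rfl] at this
        exact congrArg (· • _) this
      · intro j _ hj
        rw [iteratedDeriv_smul_const ((contDiff_id.pow _).contDiffAt)]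
        have := iteratedDeriv_fun_pow_zero (𝕜 := ℝ) (n := m) (m := (j : ℕ))
        rw [if_neg fun h => hj (Fin.ext h.symm)] at this
        exact (congrArg (· • _) this).trans (by rw [Nat.cast_zero, zero_smul])
      · intro h
        exact absurd (Finset.mem_univ _) h
    rw [h1, h2]
  have hcomp := iteratedDeriv_comp_congr (k := k) hH
    ((hcurve ℓ₁ hℓ₁s).of_le (mod_cast le_top))
    ((hcurve ℓ₂ hℓ₂s.contDiffAt).of_le (mod_cast le_top)) (by
      rintro (_ | m) hm
      · simp
      · rw [hjet ℓ₁ hℓ₁s, hjet ℓ₂ hℓ₂s.contDiffAt, hℓjet m hm])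
  -- The derivative of order k + 1 of tF is computed twice, by Leibniz and by the Hamilton–Jacobi
  -- equation.
  have hleft : iteratedDeriv (k + 1) (fun t : ℝ => t * F (y, t)) 0 =
      (k + 1 : ℝ) * iteratedDeriv k (fun t => F (y, t)) 0 :=
    iteratedDeriv_id_smul_zero (hFy.of_le (mod_cast le_top))
  have hright : iteratedDeriv (k + 1) (fun t : ℝ => t * F (y, t)) 0 =
      iteratedDeriv k (fun t => H (y + t • T (ℓ₁ t))) 0 := by
    rw [iteratedDeriv_succ']
    refine Filter.EventuallyEq.iteratedDeriv_eq k ?_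
    filter_upwards [hev] with t ht
    have hs := hasFDerivAt_slice (z := (y, t))
      ((hF.contDiffAt (hD.mem_nhds ht)).differentiableAt (by simp))
    rw [(hHJ y t ht).deriv, hpt _ t hs.differentiableAt, hs.fderiv]
  have hformal : formalCoeff (hamiltonJacobiPoint c) H k y = 1 / ((k : ℝ) + 1) *
      (1 / (k.factorial : ℝ) * iteratedDeriv k (fun t => H (y + t • T (ℓ₂ t))) 0) := by
    rw [formalCoeff]
    congr 3
    funext t
    have hd : HasFDerivAt (fun x => ∑ j : Fin k, t ^ (j : ℕ) *
        formalCoeff (hamiltonJacobiPoint c) H j x) (ℓ₂ t) y :=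
      HasFDerivAt.fun_sum fun j _ =>
        (((hcs j).differentiable (by simp) y).hasFDerivAt.const_mul _)
    rw [hpt _ t hd.differentiableAt, hd.fderiv]
  rw [hformal, ← hcomp, ← hright, hleft]
  have hk1 : (k : ℝ) + 1 ≠ 0 := by positivity
  have hk2 : (k.factorial : ℝ) ≠ 0 := by positivity
  field_simp

/-- All assertions for the scheme with rational weight `c`. -/
theorem exists_modifiedHamiltonian_expansion (n : ℕ) (c : ℚ) :
    ∃ P : ℕ → MvPolynomial (List (Fin n ⊕ Fin n)) ℚ,
      ∀ H : PhaseSpace n → ℝ, ContDiff ℝ ∞ H →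
        ∃ (W D : Set (PhaseSpace n × ℝ)) (Hhat : PhaseSpace n → ℝ → ℝ),
          IsSchemeDomain (stagePoint c) H W D ∧
          ((∃ K, LipschitzWith K (hamVec H)) →
            ∃ ε : ℝ, 0 < ε ∧ W = Set.univ ×ˢ Set.Ioo (-ε) ε ∧ D = Set.univ ×ˢ Set.Ioo (-ε) ε) ∧
          IsModifiedHamiltonian (stagePoint c) H W D Hhat ∧
          (∀ G : PhaseSpace n → ℝ → ℝ, IsModifiedHamiltonian (stagePoint c) H W D G →
            ∃ c : ℝ → ℝ, ∀ y t, (y, t) ∈ D → G y t = Hhat y t + c t) ∧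
          (∀ y t, (y, t) ∈ D → HasDerivAt (fun τ : ℝ => τ * Hhat y τ)
            (H (hamiltonJacobiPoint c (fun x => Hhat x t) t y)) t) ∧
          (∀ y h, (y, h) ∈ D → h * Hhat y h =
            ∫ t in (0 : ℝ)..h, H (hamiltonJacobiPoint c (fun x => Hhat x t) t y)) ∧
          (∀ y, ∀ N : ℕ, (fun h : ℝ => Hhat y h - ∑ k ∈ Finset.range N,
              h ^ k * formalCoeff (hamiltonJacobiPoint c) H k y) =O[𝓝 0] fun h : ℝ => h ^ N) ∧
          (∀ k y, formalCoeff (hamiltonJacobiPoint c) H k y =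
            MvPolynomial.aeval (fun l => partialDerivs H l y) (P k)) := by
  obtain ⟨P, hP⟩ := exists_formalCoeff_eq_aeval n c
  refine ⟨P, fun H hH => ?_⟩
  obtain ⟨W, D, Hhat, hdom, hLip, hmod, huniq, hHJ, hint⟩ := exists_modifiedHamiltonian (c : ℝ) hH
  refine ⟨W, D, Hhat, hdom, hLip, hmod, huniq, hHJ, hint, fun y N => ?_, hP H hH⟩
  have hcoeff := fun k => iteratedDeriv_eq_formalCoeff c hH hdom.isOpen_stage
    hdom.zero_mem_stage hmod.smooth hHJ k y
  have hline : ContDiff ℝ ∞ fun t : ℝ => (y, t) := contDiff_const.prodMk contDiff_id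
  have hT := taylor_isBigO (f := fun t => Hhat y t) (U := {t | (y, t) ∈ D})
    (hdom.isOpen_stage.preimage hline.continuous) (hdom.zero_mem_stage y)
    (hmod.smooth.comp hline.contDiffOn fun t ht => ht) N
  refine hT.congr_left fun h => ?_
  congr 1
  refine Finset.sum_congr rfl fun k _ => ?_
  rw [hcoeff k, mul_div_cancel_left₀ _ (by positivity)]

end Expansion

end

/-! ### Specialization to c = 1 and c = 1/2 -/

theorem proposition2 (n : ℕ) :
    -- (a) symplectic Euler
    (∃ P : ℕ → MvPolynomial (List (Fin n ⊕ Fin n)) ℚ,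
      ∀ H : PhaseSpace n → ℝ, ContDiff ℝ ∞ H →
        ∃ (W D : Set (PhaseSpace n × ℝ)) (Hhat : PhaseSpace n → ℝ → ℝ),
          IsSchemeDomain eulerStage H W D ∧
          ((∃ K, LipschitzWith K (hamVec H)) →
            ∃ ε : ℝ, 0 < ε ∧ W = Set.univ ×ˢ Set.Ioo (-ε) ε ∧ D = Set.univ ×ˢ Set.Ioo (-ε) ε) ∧
          IsModifiedHamiltonian eulerStage H W D Hhat ∧
          (∀ G : PhaseSpace n → ℝ → ℝ, IsModifiedHamiltonian eulerStage H W D G →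
            ∃ c : ℝ → ℝ, ∀ y t, (y, t) ∈ D → G y t = Hhat y t + c t) ∧
          (∀ p q t, ((p, q), t) ∈ D →
            HasDerivAt (fun τ : ℝ => τ * Hhat (p, q) τ)
              (H (p, q + t • gradP (fun y => Hhat y t) (p, q))) t) ∧
          (∀ p q h, ((p, q), h) ∈ D →
            h * Hhat (p, q) h =
              ∫ t in (0 : ℝ)..h, H (p, q + t • gradP (fun y => Hhat y t) (p, q))) ∧
          (∀ y, ∀ N : ℕ,
            (fun h : ℝ => Hhat y h - ∑ k ∈ Finset.range N, h ^ k * formalCoeff eulerPoint H k y)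
              =O[𝓝 0] fun h : ℝ => h ^ N) ∧
          (∀ k y, formalCoeff eulerPoint H k y =
            MvPolynomial.aeval (fun l => partialDerivs H l y) (P k))) ∧
    -- (b) implicit midpoint rule
    (∃ P : ℕ → MvPolynomial (List (Fin n ⊕ Fin n)) ℚ,
      ∀ H : PhaseSpace n → ℝ, ContDiff ℝ ∞ H →
        ∃ (W D : Set (PhaseSpace n × ℝ)) (Hhat : PhaseSpace n → ℝ → ℝ),
          IsSchemeDomain midpointStage H W D ∧
          ((∃ K, LipschitzWith K (hamVec H)) →
            ∃ ε : ℝ, 0 < ε ∧ W = Set.univ ×ˢ Set.Ioo (-ε) ε ∧ D = Set.univ ×ˢ Set.Ioo (-ε) ε) ∧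
          IsModifiedHamiltonian midpointStage H W D Hhat ∧
          (∀ G : PhaseSpace n → ℝ → ℝ, IsModifiedHamiltonian midpointStage H W D G →
            ∃ c : ℝ → ℝ, ∀ y t, (y, t) ∈ D → G y t = Hhat y t + c t) ∧
          (∀ y t, (y, t) ∈ D →
            HasDerivAt (fun τ : ℝ => τ * Hhat y τ)
              (H (y + (t / 2) • hamVec (fun x => Hhat x t) y)) t) ∧
          (∀ y h, (y, h) ∈ D →
            h * Hhat y h =
              ∫ t in (0 : ℝ)..h, H (y + (t / 2) • hamVec (fun x => Hhat x t) y)) ∧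
          (∀ y, ∀ N : ℕ,
            (fun h : ℝ =>
              Hhat y h - ∑ k ∈ Finset.range N, h ^ k * formalCoeff midpointPoint H k y)
              =O[𝓝 0] fun h : ℝ => h ^ N) ∧
          (∀ k y, formalCoeff midpointPoint H k y =
            MvPolynomial.aeval (fun l => partialDerivs H l y) (P k))) := by
  have h1 := exists_modifiedHamiltonian_expansion n 1
  have h2 := exists_modifiedHamiltonian_expansion n (1 / 2)
  push_cast at h1 h2
  rw [← eulerStage_eq_stagePoint, ← eulerPoint_eq_hamiltonJacobiPoint] at h1
  rw [← midpointStage_eq_stagePoint, ← midpointPoint_eq_hamiltonJacobiPoint] at h2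
  refine ⟨?_, h2⟩
  obtain ⟨P, hP⟩ := h1
  refine ⟨P, fun H hH => ?_⟩
  obtain ⟨W, D, Hhat, hdom, hLip, hmod, huniq, hHJ, hint, hexp, hpoly⟩ := hP H hH
  exact ⟨W, D, Hhat, hdom, hLip, hmod, huniq, fun p q => hHJ (p, q), fun p q => hint (p, q),
    hexp, hpoly⟩
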